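/- Let $\Gamma$ be an ADE Dynkin diagram ($A_n$ with $n\ge 1$, $D_n$ with $n\ge 4$, $E_6$, $E_7$ or $E_8$) with vertices $1,\dots,n$ and adjacency matrix $Ad_\Gamma$. Let $W$ be its Coxeter group with simple reflections $s_i$ and Coxeter matrix $m$. Let $\gamma=\gamma^+\gamma^-$ be its distinguished Coxeter element, where $\gamma^+$ (resp. $\gamma^-$) is the product of the commuting $s_k$ over the vertices $k$ at even (resp. odd) distance from the first vertex, a fixed end vertex of $\Gamma$, and let the Coxeter number $h$ be the order of $\gamma$ in $W$ (all Coxeter elements of $W$ have this order). Let $V_\Gamma=\bigoplus_i\mathbb R\alpha_i$ and $M_\Gamma=\bigoplus_i\mathbb Z\alpha_i$, and let $\mathfrak A=(-2\cos(\pi/m(i,j)))_{i,j}$ be the Cartan matrix, so that $2I-\mathfrak A=Ad_\Gamma$. The Coxeter plane $P_\Gamma\subseteq V_\Gamma$ is the span of the eigenvectors of $2I-\mathfrak A$ for the eigenvalues $2\cos(\pi/h)$ and $-2\cos(\pi/h)$. Let $\Delta_0=1$, $\Delta_1=x$, $\Delta_k=x\Delta_{k-1}-\Delta_{k-2}$ in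 $\mathbb Z[x]$, let $R_{h-1}=\mathbb Z[x]/(\Delta_{h-1})$ be the Verlinde ring, and let $R_{h-1}^{\mathrm{even}}\subseteq R_{h-1}$ be the subring generated by the $\Delta_{2k}$ with $0\le k\le\lfloor (h-2)/2\rfloor$. A fusion ring is a ring with a finite $\mathbb Z$-basis $\{b_i\}$ that contains $b_0=1$, with structure constants in $\mathbb Z_{\ge0}$, and with an involution $i\mapsto i^*$ that extends to an anti-automorphism and for which the coefficient of $b_0$ in $b_ib_j$ is $1$ if $i=j^*$ and $0$ otherwise; $\mathrm{FPdim}(b_i)$ is the largest real eigenvalue of the matrix of left multiplication by $b_i$. A $\mathbb Z_+$-module over it is a module with a fixed $\mathbb Z$-basis on which each $b_i$ acts by a matrix with entries in $\mathbb Z_{\ge0}$. A hypergroup is an $\mathbb R$-algebra with a finite basis $\{r_i\}$ that contains $r_0=1$, with structure constants $N_{ij}^k\ge0$ such that $\sum_kN_{ij}^k=1$, and with an involution $i\mapsto i^*$ that extends to an anti-automorphism and for which $N_{ij}^0=N_{ji}^0$, and $N_{ij}^0>0$ if and only if $j=i^*$. A fixed point of an action $\Theta$ of a hypergroup, i.e.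 of an $\mathbb R$-algebra homomorphism $\Theta$ to $\mathrm{Mat}_n(\mathbb R)$, is a vector $v\in\mathbb R^n$ with $\Theta(r_i)v=v$ for all $i$. Then $R_{h-1}$ is a fusion ring with basis $\{\Delta_k\}_{0\le k\le h-2}$, and $R_{h-1}^{\mathrm{even}}$ is one with basis $\{\Delta_{2k}\}_{0\le k\le\lfloor(h-2)/2\rfloor}$. The algebra $R_{h-1}^{\mathrm{even}}\otimes\mathbb R$ is a hypergroup with basis $\{\Delta_{2k}/\mathrm{FPdim}(\Delta_{2k})\}$, with $\mathrm{FPdim}$ taken in $R_{h-1}^{\mathrm{even}}$. There is a (unique) $R_{h-1}$-module structure on $M_\Gamma$ for which $\Delta_1$ acts by $Ad_\Gamma$, and it makes $M_\Gamma$ a $\mathbb Z_+$-module with basis $\{\alpha_i\}$. The subspace of fixed points of the induced action of the hypergroup $R_{h-1}^{\mathrm{even}}\otimes\mathbb R$ on $V_\Gamma=M_\Gamma\otimes\mathbb R$ is exactly the Coxeter plane $P_\Gamma$. Moreover, the eigenspaces of $2I-\mathfrak A$ for $2\cos(\pi/h)$ and for $-2\cos(\pi/h)$ are one-dimensional, and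 $P_\Gamma$ has dimension $2$ if $n\ge2$ (for $A_1$ we have $h=2$ and $P_\Gamma=V_\Gamma$ is a line). -/

import Mathlib

open scoped TensorProduct

noncomputable section

/-- The ADE Dynkin diagrams: `A n` for `n ≥ 1`, `D n` for `n ≥ 4`, and `E6`, `E7`, `E8`. -/
inductive ADEDiagram : Type
  | A (n : ℕ) (hn : 1 ≤ n)
  | D (n : ℕ) (hn : 4 ≤ n)
  | E6
  | E7
  | E8

namespace ADEDiagram

/-- The number of vertices. -/
def rank : ADEDiagram → ℕ
  | A n _ => n
  | D n _ => n
  | E6 => 6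
  | E7 => 7
  | E8 => 8

/-- The edges of the diagram, on vertices numbered from `0`, each listed once with its smaller
endpoint first. Vertex `j > 0` is a leaf of the subtree on `{0, ..., j}`. In type `D` the branch
vertex is `1`, with neighbours `0`, `2`, `3`; in type `E` with `r` vertices, there is a path
`0, ..., r - 2` and the last vertex `r - 1` is attached to `r - 4`. -/
def Edge : ADEDiagram → ℕ → ℕ → Prop
  | A _ _, i, j => j = i + 1
  | D _ _, i, j => (j = i + 1 ∧ j ≠ 3) ∨ (i = 1 ∧ j = 3)
  | E6, i, j => (j = i + 1 ∧ j ≠ 5) ∨ (i = 2 ∧ j = 5)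
  | E7, i, j => (j = i + 1 ∧ j ≠ 6) ∨ (i = 3 ∧ j = 6)
  | E8, i, j => (j = i + 1 ∧ j ≠ 7) ∨ (i = 4 ∧ j = 7)

instance (Γ : ADEDiagram) (i j : ℕ) : Decidable (Γ.Edge i j) := by
  cases Γ <;> unfold Edge <;> infer_instance

/-- The diagram as a simple graph. -/
def graph (Γ : ADEDiagram) : SimpleGraph (Fin Γ.rank) :=
  SimpleGraph.fromRel fun i j => Γ.Edge i j

instance (Γ : ADEDiagram) : DecidableRel Γ.graph.Adj := fun i j =>
  decidable_of_iff (i ≠ j ∧ (Γ.Edge i j ∨ Γ.Edge j i))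
    (SimpleGraph.fromRel_adj (fun i j : Fin Γ.rank => Γ.Edge i j) i j).symm

theorem rank_pos (Γ : ADEDiagram) : 0 < Γ.rank := by
  cases Γ <;> simp only [rank] <;> omega

/-- The first vertex. -/
def root (Γ : ADEDiagram) : Fin Γ.rank := ⟨0, Γ.rank_pos⟩

/-- The Coxeter matrix of the diagram: all edges are unlabelled, i.e. stand for `m(i, j) = 3`. -/
def coxeterMatrix (Γ : ADEDiagram) : CoxeterMatrix (Fin Γ.rank) where
  M := Matrix.of fun i j => if i = j then 1 else if Γ.graph.Adj i j then 3 else 2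
  isSymm := by
    ext i j
    simp [eq_comm, SimpleGraph.adj_comm]
  diagonal := by simp
  off_diagonal := by
    intro i j hij
    simp only [Matrix.of_apply, if_neg hij]
    split_ifs <;> norm_num

/-- The Coxeter group `W` of the diagram, given by the Coxeter presentation. -/
abbrev W (Γ : ADEDiagram) : Type := Γ.coxeterMatrix.Group

/-- The product of the simple reflections `s_k`, over the vertices `k` at even distance from the
first vertex (these commute with one another). -/
def gammaPlus (Γ : ADEDiagram) : Γ.W :=
  (((List.finRange Γ.rank).filter fun k => Even (Γ.graph.dist k Γ.root)).map
    Γ.coxeterMatrix.simple).prod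

/-- The product of the simple reflections `s_k`, over the vertices `k` at odd distance from the
first vertex (these commute with one another). -/
def gammaMinus (Γ : ADEDiagram) : Γ.W :=
  (((List.finRange Γ.rank).filter fun k => Odd (Γ.graph.dist k Γ.root)).map
    Γ.coxeterMatrix.simple).prod

/-- The distinguished Coxeter element `γ = γ⁺ γ⁻` of `W`. -/
def coxeterElement (Γ : ADEDiagram) : Γ.W := Γ.gammaPlus * Γ.gammaMinus

/-- The Coxeter number `h`: the order in `W` of the distinguished Coxeter element. (All Coxeter
elements of `W` are conjugate, so any other one has the same order.) -/
def coxeterNumber (Γ : ADEDiagram) : ℕ := orderOf Γ.coxeterElement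

/-- The Cartan matrix `𝔄`, with entries `⟨α_i | α_j⟩ = -2 cos (π / m(i, j))`. -/
def cartanMatrix (Γ : ADEDiagram) : Matrix (Fin Γ.rank) (Fin Γ.rank) ℝ :=
  Matrix.of fun i j => -2 * Real.cos (Real.pi / (Γ.coxeterMatrix i j : ℝ))

/-- The geometric representation space `V_Γ`, in coordinates for the basis `α_i` of simple roots;
the lattice `M_Γ` spanned by the `α_i` is `Fin Γ.rank → ℤ`. -/
abbrev V (Γ : ADEDiagram) : Type := Fin Γ.rank → ℝ

/-- The eigenspace of `2 I - 𝔄`, acting on `V_Γ`, for the number `t`. -/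
def eigenspace (Γ : ADEDiagram) (t : ℝ) : Submodule ℝ Γ.V :=
  Module.End.eigenspace
    (Matrix.toLin' ((2 : ℝ) • (1 : Matrix (Fin Γ.rank) (Fin Γ.rank) ℝ) - Γ.cartanMatrix)) t

/-- The Coxeter plane: the span of the eigenvectors of `2 I - 𝔄` for the eigenvalues
`2 cos (π / h)` and `-2 cos (π / h)`. -/
def coxeterPlane (Γ : ADEDiagram) : Submodule ℝ Γ.V :=
  Γ.eigenspace (2 * Real.cos (Real.pi / (Γ.coxeterNumber : ℝ))) ⊔
    Γ.eigenspace (-(2 * Real.cos (Real.pi / (Γ.coxeterNumber : ℝ))))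

end ADEDiagram

/-- The structure of a fusion ring on a ring `R`: a finite `ℤ`-basis `b_i` that contains `1`, with
structure constants in `ℤ₊`, and an involution `*` of the index set that extends to an
anti-automorphism of `R` and for which the coefficient of `1` in `b_i b_j` is `1` if `i = j*`, and
`0` otherwise. -/
structure FusionRing (R : Type) [Ring R] (I : Type) [Fintype I] [DecidableEq I] where
  basis : Module.Basis I ℤ R
  unit : I
  star : I → I
  basis_unit : basis unit = 1
  nonneg : ∀ i j k, 0 ≤ basis.repr (basis i * basis j) k
  star_star : ∀ i, star (star i) = i
  star_anti : ∃ φ : R ≃+* Rᵐᵒᵖ, ∀ i, φ (basis i) = MulOpposite.op (basis (star i))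
  unit_coeff : ∀ i j, basis.repr (basis i * basis j) unit = if i = star j then 1 else 0

namespace FusionRing

variable {R : Type} [Ring R] {I : Type} [Fintype I] [DecidableEq I]

/-- The matrix `N_i` of left multiplication by `b_i`, in the basis `b`. -/
def leftMulMatrix (F : FusionRing R I) (i : I) : Matrix I I ℤ :=
  Matrix.of fun k j => F.basis.repr (F.basis i * F.basis j) k

/-- The Frobenius-Perron dimension of `b_i`: the largest real eigenvalue of the non-negative matrix
`N_i`. -/
def FPdim (F : FusionRing R I) (i : I) : ℝ :=
  sSup {t : ℝ | Module.End.HasEigenvalue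
    (Matrix.toLin' ((F.leftMulMatrix i).map (Int.cast : ℤ → ℝ))) t}

/-- A left `R`-module structure on `ℤ^ι`, given by `ρ`, is a `ℤ₊`-module (for the standard basis)
if each `b_i` acts by a matrix with entries in `ℤ₊`. -/
def IsZPlusModule (F : FusionRing R I) {ι : Type} [Fintype ι] [DecidableEq ι]
    (ρ : R →+* Matrix ι ι ℤ) : Prop :=
  ∀ i k l, 0 ≤ ρ (F.basis i) k l

end FusionRing

/-- The structure of a (finite) hypergroup on an `ℝ`-algebra `A`: a finite basis `r_i` that contains
`1`, whose structure constants `N_{ij}^k` are non-negative with `∑ k, N_{ij}^k = 1`, and an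
involution `*` of the index set that extends to an anti-automorphism of `A`, such that
`N_{ij}^0 = N_{ji}^0`, and `N_{ij}^0 > 0` if and only if `j = i*`. -/
structure Hypergroup (A : Type) [Ring A] [Algebra ℝ A] (I : Type) [Fintype I] where
  basis : Module.Basis I ℝ A
  unit : I
  star : I → I
  basis_unit : basis unit = 1
  nonneg : ∀ i j k, 0 ≤ basis.repr (basis i * basis j) k
  sum_eq_one : ∀ i j, ∑ k, basis.repr (basis i * basis j) k = 1
  star_star : ∀ i, star (star i) = i
  star_anti : ∃ φ : A ≃ₐ[ℝ] Aᵐᵒᵖ, ∀ i, φ (basis i) = MulOpposite.op (basis (star i))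
  unit_coeff_comm : ∀ i j,
    basis.repr (basis i * basis j) unit = basis.repr (basis j * basis i) unit
  unit_coeff_pos : ∀ i j, 0 < basis.repr (basis i * basis j) unit ↔ j = star i

/-- The subspace of fixed points of an action `Θ` of a hypergroup on `ℝ^ι`: the vectors fixed by
`Θ (r_i)` for all basis elements `r_i`. -/
def Hypergroup.fixedPoints {A : Type} [Ring A] [Algebra ℝ A] {I : Type} [Fintype I]
    (H : Hypergroup A I) {ι : Type} [Fintype ι] [DecidableEq ι] (Θ : A →ₐ[ℝ] Matrix ι ι ℝ) :
    Submodule ℝ (ι → ℝ) where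
  carrier := {v | ∀ i, (Θ (H.basis i)).mulVec v = v}
  zero_mem' := by simp
  add_mem' := by
    intro v w hv hw i
    rw [Matrix.mulVec_add, hv i, hw i]
  smul_mem' := by
    intro c v hv i
    rw [Matrix.mulVec_smul, hv i]

/-- The extension of scalars to `ℝ` of an action of a ring `R` on `ℤ^ι`: the action of `ℝ ⊗ R` on
`ℝ^ι` in which `c ⊗ x` acts by `c • ρ x`. -/
def extendScalars {R : Type} [Ring R] {ι : Type} [Fintype ι] [DecidableEq ι]
    (ρ : R →+* Matrix ι ι ℤ) : ℝ ⊗[ℤ] R →ₐ[ℝ] Matrix ι ι ℝ :=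
  Algebra.TensorProduct.lift (Algebra.ofId ℝ (Matrix ι ι ℝ))
    (((Int.castRingHom ℝ).mapMatrix.comp ρ).toIntAlgHom)
    (fun c _ => Algebra.commutes c _)

theorem extendScalars_tmul {R : Type} [Ring R] {ι : Type} [Fintype ι] [DecidableEq ι]
    (ρ : R →+* Matrix ι ι ℤ) (c : ℝ) (x : R) :
    extendScalars ρ (c ⊗ₜ[ℤ] x) = c • (ρ x).map (Int.cast : ℤ → ℝ) :=
  (Algebra.TensorProduct.lift_tmul _ _ _ _ _).trans
    (Algebra.smul_def c ((ρ x).map (Int.cast : ℤ → ℝ))).symm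

/-- The Verlinde ring `R_n = ℤ[x] / (Δ_n(x))`, where `Δ_k` is the normalised Chebyshev polynomial of
the second kind: `Δ_0 = 1`, `Δ_1 = x`, `Δ_k = x Δ_{k-1} - Δ_{k-2}`. -/
abbrev VerlindeRing (n : ℕ) : Type := AdjoinRoot (Polynomial.Chebyshev.S ℤ (n : ℤ))

/-- The class of `Δ_k` in `R_n`. -/
def verlindeDelta (n k : ℕ) : VerlindeRing n :=
  AdjoinRoot.mk (Polynomial.Chebyshev.S ℤ (n : ℤ)) (Polynomial.Chebyshev.S ℤ (k : ℤ))

/-- The even part of `R_n`: the subring generated by the `Δ_{2k}` with `0 ≤ k ≤ ⌊(n - 1) / 2⌋`. -/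
def verlindeEven (n : ℕ) : Subring (VerlindeRing n) :=
  Subring.closure {x | ∃ k : ℕ, k ≤ (n - 1) / 2 ∧ x = verlindeDelta n (2 * k)}

end

/-!
The adjacency matrix `A` of an ADE diagram has a positive eigenvector `v`, which is written down
explicitly with Chebyshev values, with eigenvalue `t = 2 cos (π / N)`. In the geometric
representation the two factors of the Coxeter element act on the solutions of
`Y (k + 2) = A Y (k + 1) - Y k` by shifting them, so `(S_k + S_{k-1})(A) α_j` is a root. Its pairing
with `v` is positive for `k < N`, and a root is either nonnegative or nonpositive; sorting the
vertices by colour gives `S_k(A) ≥ 0` for `k < N`. As `S_{N-1}(t) = 0`, the nonnegative matrix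
`S_{N-1}(A)` kills the positive vector `v`, so it vanishes. The recursion is then `2N`-periodic,
whence `γ ^ N = 1`, and its solution built from `v` and cosines shows that the order `h` of `γ` is
exactly `N`.

For the path with `h - 1` vertices this says that `Δ_k ↦ S_k(A)` is the regular representation of
the Verlinde ring, with nonnegative entries. The Frobenius–Perron dimension is the character
`Δ_k ↦ S_k(t)`, since a character that is positive on the basis is a positive left eigenvector of
every left multiplication. Hence `w` is a fixed point if and only if `S_{2k}(A) w = S_{2k}(t) w` for
all `k`. As `S_{2k}` is a polynomial in `x ^ 2` and `S_2 = x ^ 2 - 1`, this says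
`A ^ 2 w = t ^ 2 w`, which describes the Coxeter plane.
-/

noncomputable section

open Matrix Polynomial

section Chebyshev

variable {R : Type*} [CommRing R]

theorem chebyshevS_add_two_mul (k N : ℤ) :
    Chebyshev.S R (k + 2 * N) =
      Chebyshev.S R k + Chebyshev.C R (k + 1 + N) * Chebyshev.S R (N - 1) := by
  suffices ∀ m : ℤ, Chebyshev.S R (m - 1 + N) =
      Chebyshev.S R (m - 1 - N) + Chebyshev.C R m * Chebyshev.S R (N - 1) by
    convert this (k + 1 + N) using 2 <;> ring_nf
  intro m
  induction m using Chebyshev.induct with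
  | zero =>
    rw [show (0 : ℤ) - 1 - N = -(N - 1) - 2 by ring, Chebyshev.S_neg_sub_two, Chebyshev.C_zero,
      show (0 : ℤ) - 1 + N = N - 1 by ring]
    ring
  | one =>
    rw [show (1 : ℤ) - 1 - N = -(N - 2) - 2 by ring, Chebyshev.S_neg_sub_two, Chebyshev.C_one,
      show (1 : ℤ) - 1 + N = N - 2 + 2 by ring, Chebyshev.S_add_two]
    ring_nf
  | add_two m h1 h0 =>
    have e1 := Chebyshev.S_add_two R (m - 1 + N)
    have e2 := Chebyshev.S_add_two R (m - 1 - N)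
    have e3 := Chebyshev.C_add_two R m
    ring_nf at h0 h1 e1 e2 e3 ⊢
    linear_combination e1 - e2 + X * h1 - h0 - Chebyshev.S R (-1 + N) * e3
  | neg_add_one m h0 h1 =>
    have e1 := Chebyshev.S_sub_one R (-m - 1 + N)
    have e2 := Chebyshev.S_sub_one R (-m - 1 - N)
    have e3 := Chebyshev.C_sub_one R (-m)
    ring_nf at h0 h1 e1 e2 e3 ⊢
    linear_combination e1 - e2 + X * h0 - h1 - Chebyshev.S R (-1 + N) * e3

theorem aeval_chebyshevS_add_two_mul {A : Type*} [Ring A] [Algebra R A] {x : A} {N : ℤ}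
    (hx : aeval x (Chebyshev.S R (N - 1)) = 0) (k : ℤ) :
    aeval x (Chebyshev.S R (k + 2 * N)) = aeval x (Chebyshev.S R k) := by
  rw [chebyshevS_add_two_mul, map_add, map_mul, hx, mul_zero, add_zero]

theorem exists_chebyshevS_two_mul_eq_expand (k : ℕ) :
    ∃ q : R[X], Chebyshev.S R (2 * k) = expand R 2 q := by
  induction k using Nat.twoStepInduction with
  | zero => exact ⟨1, by simp⟩
  | one => exact ⟨X - 1, by simp [Chebyshev.S_two]⟩
  | more k h0 h1 =>
    obtain ⟨p, hp⟩ := h0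
    obtain ⟨q, hq⟩ := h1
    refine ⟨(X - 2) * q - p, ?_⟩
    have e0 := Chebyshev.S_add_two R (2 * k)
    have e1 := Chebyshev.S_add_two R (2 * k + 1)
    have e2 := Chebyshev.S_add_two R (2 * k + 2)
    simp only [map_sub, map_mul, expand_X, ← hp, ← hq, map_ofNat]
    push_cast
    ring_nf at e0 e1 e2 ⊢
    linear_combination e2 + X * e1 + e0

theorem aeval_neg_chebyshevS {A : Type*} [Ring A] [Algebra R A] (x : A) (k : ℕ) :
    aeval (-x) (Chebyshev.S R k) = (-1) ^ k * aeval x (Chebyshev.S R k) := by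
  induction k using Nat.twoStepInduction with
  | zero => simp
  | one => simp
  | more k h0 h1 =>
    push_cast at h0 h1 ⊢
    simp only [Chebyshev.S_add_two, map_sub, map_mul, aeval_X, h0, h1, pow_succ]
    rcases neg_one_pow_eq_or A k with hk | hk <;> rw [hk] <;> noncomm_ring

theorem sin_mul_pi_div_pos {h k : ℕ} (hk : 0 < k) (hkh : k < h) :
    0 < Real.sin (k * (Real.pi / h)) := by
  have hkh' : (k : ℝ) < h := by exact_mod_cast hkh
  have hh : (0 : ℝ) < h := hkh'.trans_le' k.cast_nonneg
  refine Real.sin_pos_of_pos_of_lt_pi (by positivity) ?_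
  rwa [← mul_div_assoc, div_lt_iff₀ hh, mul_comm, mul_lt_mul_iff_right₀ Real.pi_pos]

theorem sin_pi_div_pos {h : ℕ} (hh : 2 ≤ h) : 0 < Real.sin (Real.pi / h) := by
  simpa using sin_mul_pi_div_pos one_pos hh

theorem eval_chebyshevS_pos {h k : ℕ} (hk : k + 1 < h) :
    0 < (Chebyshev.S ℝ k).eval (2 * Real.cos (Real.pi / h)) := by
  refine pos_of_mul_pos_left ?_ (sin_pi_div_pos (h := h) (by omega)).le
  rw [Chebyshev.S_two_mul_real_cos]
  exact_mod_cast sin_mul_pi_div_pos k.succ_pos hk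

theorem eval_chebyshevS_sub_one_eq_zero {h : ℕ} (hh : 2 ≤ h) :
    (Chebyshev.S ℝ (h - 1)).eval (2 * Real.cos (Real.pi / h)) = 0 := by
  have hh' : (h : ℝ) ≠ 0 := Nat.cast_ne_zero.mpr (by omega)
  refine (mul_eq_zero_iff_right (sin_pi_div_pos hh).ne').mp ?_
  rw [Chebyshev.S_two_mul_real_cos]
  push_cast
  rw [sub_add_cancel, mul_div_cancel₀ _ hh', Real.sin_pi]

theorem eval_chebyshevS_nonneg {h k : ℕ} (hk : k < h) (hh : 2 ≤ h) :
    0 ≤ (Chebyshev.S ℝ k).eval (2 * Real.cos (Real.pi / h)) := by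
  obtain hk | rfl : k + 1 < h ∨ h = k + 1 := by omega
  · exact (eval_chebyshevS_pos hk).le
  · simpa using (eval_chebyshevS_sub_one_eq_zero hh).ge

end Chebyshev

section Matrix

variable {ι : Type*} [Fintype ι] [DecidableEq ι]

theorem isSymm_aeval {R : Type*} [CommRing R] {A : Matrix ι ι R} (hA : A.IsSymm) (p : R[X]) :
    (aeval A p).IsSymm := by
  induction p using Polynomial.induction_on' with
  | add p q hp hq => rw [map_add]; exact hp.add hq
  | monomial k c => rw [aeval_monomial, ← Algebra.smul_def]; exact (hA.pow k).smul c

theorem aeval_mulVec_of_mulVec_eq_smul {R : Type*} [CommRing R] {A : Matrix ι ι R} {t : R}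
    {v : ι → R} (h : A *ᵥ v = t • v) (p : R[X]) : aeval A p *ᵥ v = p.eval t • v := by
  have h' : toLinAlgEquiv' A v = t • v := h
  rw [← Module.End.aeval_apply_of_mem_apply_eq_smul h', aeval_algHom_apply]
  rfl

theorem mem_eigenspace_toLin'_iff {K : Type*} [CommRing K] {A : Matrix ι ι K} {t : K} {v : ι → K} :
    v ∈ Module.End.eigenspace (toLin' A) t ↔ A *ᵥ v = t • v := by
  rw [Module.End.mem_eigenspace_iff, toLin'_apply]

theorem eigenspace_sup_eigenspace_neg {A : Matrix ι ι ℝ} (hA : A.IsSymm) (t : ℝ) :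
    Module.End.eigenspace (toLin' A) t ⊔ Module.End.eigenspace (toLin' A) (-t) =
      Module.End.eigenspace (toLin' (A ^ 2)) (t ^ 2) := by
  ext v
  simp only [Submodule.mem_sup, mem_eigenspace_toLin'_iff, sq, ← mulVec_mulVec, mul_smul]
  constructor
  · rintro ⟨x, hx, y, hy, rfl⟩
    simp only [mulVec_add, hx, hy, mulVec_smul]
    module
  intro hv
  obtain rfl | ht := eq_or_ne t 0
  · have hAv : A *ᵥ v = 0 := by
      rw [← conjTranspose_mul_self_mulVec_eq_zero, conjTranspose_eq_transpose_of_trivial, hA,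
        ← mulVec_mulVec, hv, zero_smul]
    exact ⟨v, by rw [hAv, zero_smul], 0, by simp, add_zero v⟩
  · refine ⟨(2 * t)⁻¹ • (t • v + A *ᵥ v), ?_, (2 * t)⁻¹ • (t • v - A *ᵥ v), ?_, ?_⟩
    · rw [mulVec_smul, mulVec_add, mulVec_smul, hv]
      module
    · rw [mulVec_smul, mulVec_sub, mulVec_smul, hv]
      module
    · match_scalars <;> field_simp <;> norm_num

end Matrix

section Graph

variable {V : Type*} [Fintype V] {G : SimpleGraph V} [DecidableRel G.Adj]

theorem eq_zero_of_adjMatrix_mulVec_eq_smul (hG : G.Connected) {t : ℝ} {u : V → ℝ} (hu : 0 ≤ u)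
    (h : G.adjMatrix ℝ *ᵥ u = t • u) {i : V} (hi : u i = 0) : u = 0 := by
  have propagate {j k : V} (hjk : G.Adj j k) (hj : u j = 0) : u k = 0 := by
    have hsum : ∑ l ∈ G.neighborFinset j, u l = 0 := by
      rw [← G.adjMatrix_mulVec_apply, h, Pi.smul_apply, hj, smul_zero]
    exact (Finset.sum_eq_zero_iff_of_nonneg fun l _ => hu l).mp hsum k (by simpa using hjk)
  ext k
  obtain ⟨p⟩ := hG.preconnected i k
  induction p with
  | nil => exact hi
  | cons hadj _ ih => exact ih (propagate hadj hi)

/-- A Perron-Frobenius eigenvector of (the adjacency matrix of) a graph: an eigenvector all of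
whose entries are positive. -/
structure IsPerronVector (G : SimpleGraph V) [DecidableRel G.Adj] (t : ℝ) (v : V → ℝ) : Prop where
  pos : ∀ i, 0 < v i
  mulVec_eq : G.adjMatrix ℝ *ᵥ v = t • v

variable {t : ℝ} {v : V → ℝ}

theorem IsPerronVector.eigenvalue_pos [Nontrivial V] (H : IsPerronVector G t v)
    (hG : G.Connected) : 0 < t := by
  obtain ⟨i⟩ := hG.nonempty
  obtain ⟨j, hij⟩ := hG.preconnected.exists_adj_of_nontrivial i
  refine pos_of_mul_pos_left (b := v i) ?_ (H.pos i).le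
  rw [← smul_eq_mul, ← Pi.smul_apply, ← H.mulVec_eq, G.adjMatrix_mulVec_apply]
  exact Finset.sum_pos (fun k _ => H.pos k) ⟨j, by simpa using hij⟩

/-- The involution of `ℝ^V` that changes the signs of the coordinates at the vertices coloured
`false`. -/
def colorSign (c : V → Bool) : (V → ℝ) ≃ₗ[ℝ] (V → ℝ) :=
  LinearEquiv.piCongrRight fun i => LinearEquiv.smulOfUnit (if c i then 1 else -1)

omit [Fintype V] in
theorem colorSign_apply (c : V → Bool) (w : V → ℝ) (i : V) :
    colorSign c w i = if c i then w i else -w i := by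
  cases hi : c i <;> simp [colorSign, LinearEquiv.smulOfUnit, Units.smul_def, hi]

theorem adjMatrix_mulVec_colorSign (c : G.Coloring Bool) (w : V → ℝ) :
    G.adjMatrix ℝ *ᵥ colorSign c w = -colorSign c (G.adjMatrix ℝ *ᵥ w) := by
  ext i
  simp only [G.adjMatrix_mulVec_apply, Pi.neg_apply, colorSign_apply]
  have hij {j : V} (hj : j ∈ G.neighborFinset i) : c j = !c i := by
    have := c.valid ((G.mem_neighborFinset i j).mp hj)
    grind
  cases hi : c i <;> simp +contextual [hij, hi]

variable [DecidableEq V]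

theorem IsPerronVector.finrank_eigenspace (H : IsPerronVector G t v) (hG : G.Connected) :
    Module.finrank ℝ (Module.End.eigenspace (toLin' (G.adjMatrix ℝ)) t) = 1 := by
  have := hG.nonempty
  have hv : v ≠ 0 := fun h => (H.pos (Classical.arbitrary V)).ne' (congrFun h _)
  refine finrank_eq_one_iff_of_nonzero' ⟨v, mem_eigenspace_toLin'_iff.mpr H.mulVec_eq⟩
    (fun h => hv (congrArg Subtype.val h)) |>.mpr fun ⟨w, hw⟩ => ?_
  rw [mem_eigenspace_toLin'_iff] at hw
  obtain ⟨i, hi⟩ := Finite.exists_min fun i => w i / v i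
  have hu : w - (w i / v i) • v = 0 := by
    refine eq_zero_of_adjMatrix_mulVec_eq_smul hG (t := t) (i := i) (fun j => ?_) ?_ ?_
    · simpa using (le_div_iff₀ (H.pos j)).mp (hi j)
    · rw [mulVec_sub, mulVec_smul, hw, H.mulVec_eq, smul_sub, smul_comm]
    · simp [(H.pos i).ne']
  exact ⟨w i / v i, Subtype.ext (sub_eq_zero.mp hu).symm⟩

theorem finrank_eigenspace_neg (c : G.Coloring Bool) (t : ℝ) :
    Module.finrank ℝ (Module.End.eigenspace (toLin' (G.adjMatrix ℝ)) (-t)) =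
      Module.finrank ℝ (Module.End.eigenspace (toLin' (G.adjMatrix ℝ)) t) := by
  have hmap : (Module.End.eigenspace (toLin' (G.adjMatrix ℝ)) (-t)).map (colorSign c).toLinearMap =
      Module.End.eigenspace (toLin' (G.adjMatrix ℝ)) t := by
    rw [← Submodule.map_comap_eq_of_surjective (colorSign c).surjective
      (Module.End.eigenspace (toLin' (G.adjMatrix ℝ)) t)]
    congr 1
    ext w
    rw [Submodule.mem_comap, mem_eigenspace_toLin'_iff, mem_eigenspace_toLin'_iff,
      LinearEquiv.coe_coe, adjMatrix_mulVec_colorSign, neg_eq_iff_eq_neg, ← neg_smul,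
      ← map_smul, (colorSign c).injective.eq_iff]
  rw [← hmap, LinearEquiv.finrank_map_eq]

theorem IsPerronVector.finrank_eigenspace_sup [Nontrivial V] (H : IsPerronVector G t v)
    (hG : G.Connected) (c : G.Coloring Bool) :
    Module.finrank ℝ ↑(Module.End.eigenspace (toLin' (G.adjMatrix ℝ)) t ⊔
      Module.End.eigenspace (toLin' (G.adjMatrix ℝ)) (-t)) = 2 := by
  have ht := H.eigenvalue_pos hG
  have hinf : Module.End.eigenspace (toLin' (G.adjMatrix ℝ)) t ⊓
      Module.End.eigenspace (toLin' (G.adjMatrix ℝ)) (-t) = ⊥ :=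
    (Module.End.disjoint_genEigenspace _ (by linarith) 1 1).eq_bot
  have hsum := Submodule.finrank_sup_add_finrank_inf_eq
    (Module.End.eigenspace (toLin' (G.adjMatrix ℝ)) t)
    (Module.End.eigenspace (toLin' (G.adjMatrix ℝ)) (-t))
  rwa [hinf, finrank_bot, add_zero, finrank_eigenspace_neg c, H.finrank_eigenspace hG] at hsum

end Graph

section CoxeterLength

variable {B W : Type*} [Group W] {M : CoxeterMatrix B} (cs : CoxeterSystem M W)

theorem simple_mul_simple_comm {i j : B} (h : M i j = 2) :
    cs.simple i * cs.simple j = cs.simple j * cs.simple i := by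
  have h2 := cs.simple_mul_simple_pow i j
  rwa [h, pow_two, mul_eq_one_iff_eq_inv, _root_.mul_inv_rev, cs.inv_simple, cs.inv_simple] at h2

theorem simple_mul_simple_mul_simple {i j : B} (h : M i j = 3) :
    cs.simple i * cs.simple j * cs.simple i = cs.simple j * cs.simple i * cs.simple j := by
  have h3 := cs.simple_mul_simple_pow i j
  rw [h, show (cs.simple i * cs.simple j) ^ 3 = (cs.simple i * cs.simple j * cs.simple i) *
    (cs.simple j * cs.simple i * cs.simple j) by simp only [pow_succ, pow_zero, one_mul, mul_assoc],
    mul_eq_one_iff_eq_inv] at h3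
  simpa [mul_assoc] using h3

theorem length_lt_length_mul_simple_of_comm {i j : B} (h : M j i = 2) {v : W}
    (hv : cs.length v < cs.length (v * cs.simple j))
    (hvi : cs.length (v * cs.simple j) < cs.length (v * cs.simple j * cs.simple i)) :
    cs.length v < cs.length (v * cs.simple i) := by
  rw [mul_assoc, simple_mul_simple_comm cs h, ← mul_assoc] at hvi
  have h1 := cs.length_mul_simple (v * cs.simple i) j
  have h2 := cs.length_mul_simple v i
  omega

theorem length_lt_length_mul_simple_of_braid {i j : B} (h : M i j = 3) {u : W}
    (hu : cs.length u < cs.length (u * cs.simple i))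
    (hui : cs.length (u * cs.simple i) < cs.length (u * cs.simple i * cs.simple j))
    (huij : cs.length (u * cs.simple i * cs.simple j) <
      cs.length (u * cs.simple i * cs.simple j * cs.simple i)) :
    cs.length u < cs.length (u * cs.simple j) := by
  have hbraid : u * cs.simple i * cs.simple j * cs.simple i =
      u * cs.simple j * cs.simple i * cs.simple j := by
    simpa only [mul_assoc] using congrArg (u * ·) (simple_mul_simple_mul_simple cs h)
  rw [hbraid] at huij
  have h1 := cs.length_mul_simple (u * cs.simple j * cs.simple i) j
  have h2 := cs.length_mul_simple (u * cs.simple j) i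
  have h3 := cs.length_mul_simple u j
  omega

theorem exists_eq_mul_simple_of_ne_one {w : W} (hw : w ≠ 1) :
    ∃ v j, w = v * cs.simple j ∧ cs.length v < cs.length w := by
  obtain ⟨j, hj⟩ := cs.exists_rightDescent_of_ne_one hw
  exact ⟨w * cs.simple j, j, by simp, hj⟩

end CoxeterLength

section GeometricRepresentation

variable {V : Type*} [DecidableEq V] (G : SimpleGraph V) [DecidableRel G.Adj]

/-- The simply laced Coxeter matrix of a graph: `m(i, j)` is `3` for adjacent vertices and `2` for
distinct non-adjacent ones. -/
def graphCoxeterMatrix : CoxeterMatrix V where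
  M := Matrix.of fun i j => if i = j then 1 else if G.Adj i j then 3 else 2
  isSymm := by
    ext i j
    simp [eq_comm, SimpleGraph.adj_comm]
  diagonal := by simp
  off_diagonal := by
    intro i j hij
    simp only [Matrix.of_apply, if_neg hij]
    split_ifs <;> norm_num

variable {G}

theorem graphCoxeterMatrix_of_adj {i j : V} (h : G.Adj i j) : graphCoxeterMatrix G i j = 3 :=
  (if_neg h.ne).trans (if_pos h)

theorem graphCoxeterMatrix_of_not_adj {i j : V} (hij : i ≠ j) (h : ¬G.Adj i j) :
    graphCoxeterMatrix G i j = 2 :=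
  (if_neg hij).trans (if_neg h)

variable [Fintype V]

variable (G) in
/-- The linear form `⟨α_i | ·⟩` on the space of the geometric representation, in coordinates for the
basis of simple roots `α_j`, normalised by `⟨α_i | α_i⟩ = 2`. -/
def rootForm (i : V) : (V → ℝ) →ₗ[ℝ] ℝ :=
  (2 : ℝ) • LinearMap.proj i - LinearMap.proj i ∘ₗ (G.adjMatrix ℝ).mulVecLin

omit [DecidableEq V] in
theorem rootForm_apply (i : V) (v : V → ℝ) :
    rootForm G i v = 2 * v i - (G.adjMatrix ℝ *ᵥ v) i :=
  rfl

theorem rootForm_single (i j : V) :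
    rootForm G i (Pi.single j 1) = if i = j then 2 else if G.Adj i j then -1 else 0 := by
  rw [rootForm_apply, Matrix.mulVec_single_one]
  by_cases hij : i = j
  · simp [hij]
  · by_cases h : G.Adj i j <;> simp [hij, h]

variable (G) in
/-- The reflection in the simple root `α_i`. -/
def simpleReflection (i : V) : Module.End ℝ (V → ℝ) :=
  1 - (rootForm G i).smulRight (Pi.single i 1)

theorem simpleReflection_apply (i : V) (v : V → ℝ) :
    simpleReflection G i v = v - rootForm G i v • Pi.single i 1 :=
  rfl

theorem simpleReflection_apply_self (i : V) (v : V → ℝ) :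
    simpleReflection G i v i = (G.adjMatrix ℝ *ᵥ v) i - v i := by
  simp only [simpleReflection_apply, rootForm_apply, Pi.sub_apply, Pi.smul_apply,
    Pi.single_eq_same, smul_eq_mul]
  ring

theorem simpleReflection_apply_of_ne {i k : V} (h : k ≠ i) (v : V → ℝ) :
    simpleReflection G i v k = v k := by
  simp [simpleReflection_apply, h]

theorem simpleReflection_single_self (i : V) :
    simpleReflection G i (Pi.single i 1) = -Pi.single i 1 := by
  rw [simpleReflection_apply, rootForm_single, if_pos rfl]
  module

theorem simpleReflection_single_of_adj {i j : V} (h : G.Adj i j) :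
    simpleReflection G i (Pi.single j 1) = Pi.single j 1 + Pi.single i 1 := by
  rw [simpleReflection_apply, rootForm_single, if_neg h.ne, if_pos h]
  module

theorem simpleReflection_single_of_not_adj {i j : V} (hij : i ≠ j) (h : ¬G.Adj i j) :
    simpleReflection G i (Pi.single j 1) = Pi.single j 1 := by
  rw [simpleReflection_apply, rootForm_single, if_neg hij, if_neg h]
  module

theorem isLiftable_simpleReflection : (graphCoxeterMatrix G).IsLiftable (simpleReflection G) := by
  intro i j
  refine LinearMap.ext fun v => ?_
  rcases eq_or_ne i j with rfl | hij
  · rw [(graphCoxeterMatrix G).diagonal, pow_one]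
    simp only [Module.End.mul_apply, simpleReflection_apply, map_sub, map_smul, rootForm_single,
      if_pos, Module.End.one_apply]
    module
  by_cases h : G.Adj i j
  · rw [graphCoxeterMatrix_of_adj h]
    simp only [pow_succ, pow_zero, one_mul, Module.End.mul_apply, simpleReflection_apply,
      map_sub, map_smul, rootForm_single, if_pos, if_neg hij, if_neg hij.symm, if_pos h,
      if_pos h.symm, Module.End.one_apply]
    module
  · have h' : ¬G.Adj j i := fun h' => h h'.symm
    rw [graphCoxeterMatrix_of_not_adj hij h]
    simp only [pow_two, Module.End.mul_apply, simpleReflection_apply, map_sub, map_smul,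
      rootForm_single, if_pos, if_neg hij, if_neg hij.symm, if_neg h, if_neg h',
      Module.End.one_apply]
    module

variable {W : Type*} [Group W] (cs : CoxeterSystem (graphCoxeterMatrix G) W)

/-- The geometric representation of a simply laced Coxeter group, in the basis of simple roots. -/
def geomRep : W →* Module.End ℝ (V → ℝ) :=
  cs.lift ⟨simpleReflection G, isLiftable_simpleReflection⟩

theorem geomRep_simple (i : V) : geomRep cs (cs.simple i) = simpleReflection G i :=
  cs.lift_apply_simple isLiftable_simpleReflection i

theorem geomRep_mul_simple (w : W) (i : V) (v : V → ℝ) :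
    geomRep cs (w * cs.simple i) v = geomRep cs w (simpleReflection G i v) := by
  rw [map_mul, geomRep_simple, Module.End.mul_apply]

theorem geomRep_mul_simple_single_self (w : W) (i : V) :
    geomRep cs (w * cs.simple i) (Pi.single i 1) = -geomRep cs w (Pi.single i 1) := by
  rw [geomRep_mul_simple, simpleReflection_single_self, map_neg]

theorem geomRep_mul_simple_single_of_adj (w : W) {i j : V} (h : G.Adj i j) :
    geomRep cs (w * cs.simple i) (Pi.single j 1) =
      geomRep cs w (Pi.single j 1) + geomRep cs w (Pi.single i 1) := by
  rw [geomRep_mul_simple, simpleReflection_single_of_adj h, map_add]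

-- The key fact about the geometric representation: if `w` is shorter than `w s_i`, then `w α_i` is
-- a positive root.
theorem geomRep_single_nonneg {w : W} {i : V}
    (hw : cs.length w < cs.length (w * cs.simple i)) : 0 ≤ geomRep cs w (Pi.single i 1) := by
  induction hn : cs.length w using Nat.strong_induction_on generalizing w i with
  | _ n ih =>
  subst hn
  rcases eq_or_ne w 1 with rfl | hw1
  · simp
  obtain ⟨v, j, rfl, hv⟩ := exists_eq_mul_simple_of_ne_one cs hw1
  have hij : j ≠ i := by
    rintro rfl
    rw [cs.simple_mul_simple_cancel_right] at hw
    omega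
  by_cases hadj : G.Adj j i
  · rw [geomRep_mul_simple_single_of_adj cs v hadj]
    have hvj : 0 ≤ geomRep cs v (Pi.single j 1) := ih _ hv hv rfl
    by_cases hvi : cs.length v < cs.length (v * cs.simple i)
    · exact add_nonneg (ih _ hv hvi rfl) hvj
    -- Otherwise `v = u s_i`, and `v s_j α_i = u s_i s_j α_i = u α_j`.
    obtain ⟨u, rfl⟩ : ∃ u, v = u * cs.simple i := ⟨v * cs.simple i, by simp⟩
    rw [cs.simple_mul_simple_cancel_right] at hvi
    have hu : cs.length u < cs.length (u * cs.simple i) := by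
      have := cs.length_mul_simple u i
      omega
    rw [geomRep_mul_simple_single_self, geomRep_mul_simple_single_of_adj cs u hadj.symm,
      neg_add_cancel_comm_assoc]
    exact ih _ (hu.trans hv)
      (length_lt_length_mul_simple_of_braid cs (graphCoxeterMatrix_of_adj hadj.symm) hu hv hw) rfl
  · rw [geomRep_mul_simple, simpleReflection_single_of_not_adj hij hadj]
    exact ih _ hv
      (length_lt_length_mul_simple_of_comm cs (graphCoxeterMatrix_of_not_adj hij hadj) hv hw) rfl

theorem geomRep_single_nonpos {w : W} {i : V}
    (hw : cs.length (w * cs.simple i) < cs.length w) : geomRep cs w (Pi.single i 1) ≤ 0 := by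
  rw [← neg_nonneg, ← geomRep_mul_simple_single_self]
  exact geomRep_single_nonneg cs (by rwa [cs.simple_mul_simple_cancel_right])

theorem geomRep_single_nonneg_or_nonpos (w : W) (i : V) :
    0 ≤ geomRep cs w (Pi.single i 1) ∨ geomRep cs w (Pi.single i 1) ≤ 0 := by
  rcases cs.length_mul_simple w i with h | h
  · exact Or.inl (geomRep_single_nonneg cs (by omega))
  · exact Or.inr (geomRep_single_nonpos cs (by omega))

theorem geomRep_injective : Function.Injective (geomRep cs) := by
  refine (injective_iff_map_eq_one _).2 fun w hw => by_contra fun hw1 => ?_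
  obtain ⟨i, hi⟩ := cs.exists_rightDescent_of_ne_one hw1
  have h := geomRep_single_nonpos cs hi i
  rw [hw, Module.End.one_apply, Pi.single_eq_same, Pi.zero_apply] at h
  exact one_pos.not_ge h

theorem geomRep_prod_map_simple {l : List V} (hl : l.Nodup)
    (hadj : ∀ i ∈ l, ∀ j ∈ l, ¬G.Adj i j) (v : V → ℝ) (k : V) :
    geomRep cs (l.map cs.simple).prod v k =
      if k ∈ l then (G.adjMatrix ℝ *ᵥ v) k - v k else v k := by
  induction l generalizing k with
  | nil => simp
  | cons i l ih =>
    rw [List.nodup_cons] at hl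
    have ih := ih hl.2 fun i hi j hj =>
      hadj i (List.mem_cons_of_mem _ hi) j (List.mem_cons_of_mem _ hj)
    rw [List.map_cons, List.prod_cons, map_mul, Module.End.mul_apply, geomRep_simple]
    rcases eq_or_ne k i with rfl | hki
    · have hA : (G.adjMatrix ℝ *ᵥ geomRep cs (l.map cs.simple).prod v) k =
          (G.adjMatrix ℝ *ᵥ v) k := by
        simp only [G.adjMatrix_mulVec_apply]
        refine Finset.sum_congr rfl fun u hu => ?_
        rw [ih, if_neg fun hul => hadj k List.mem_cons_self u (List.mem_cons_of_mem _ hul)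
          ((G.mem_neighborFinset k u).mp hu)]
      rw [simpleReflection_apply_self, hA, ih, if_neg hl.1, if_pos List.mem_cons_self]
    · rw [simpleReflection_apply_of_ne hki, ih]
      simp only [List.mem_cons, hki, false_or]

end GeometricRepresentation

theorem exists_coloring_eq_true {V : Type*} {G : SimpleGraph V} (c : G.Coloring Bool)
    (j : V) : ∃ c' : G.Coloring Bool, c' j = true := by
  cases hj : c j
  · exact ⟨.mk (fun i => !c i) fun h => by simpa using c.valid h, congrArg (!·) hj⟩
  · exact ⟨c, hj⟩

section AlternatingSequence

variable {V : Type*} [Fintype V] {G : SimpleGraph V} [DecidableRel G.Adj] {c : G.Coloring Bool}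
  {Y : ℕ → V → ℝ}

/-- The product of the (commuting) simple reflections at the vertices of colour `b`. -/
def colorReflection (c : G.Coloring Bool) (b : Bool) : Module.End ℝ (V → ℝ) where
  toFun v k := if c k = b then (G.adjMatrix ℝ *ᵥ v) k - v k else v k
  map_add' v w := by
    ext k
    simp only [Matrix.mulVec_add, Pi.add_apply]
    split_ifs <;> ring
  map_smul' r v := by
    ext k
    simp only [Matrix.mulVec_smul, Pi.smul_apply, smul_eq_mul, RingHom.id_apply]
    split_ifs <;> ring

theorem colorReflection_apply (c : G.Coloring Bool) (b : Bool) (v : V → ℝ) (k : V) :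
    colorReflection c b v k = if c k = b then (G.adjMatrix ℝ *ᵥ v) k - v k else v k :=
  rfl

theorem adjMatrix_mulVec_eq_zero_of_color {b : Bool} {x : V → ℝ} (hx : ∀ i, c i ≠ b → x i = 0)
    {i : V} (hi : c i = b) : (G.adjMatrix ℝ *ᵥ x) i = 0 := by
  rw [G.adjMatrix_mulVec_apply]
  refine Finset.sum_eq_zero fun j hj => hx j ?_
  rw [← hi]
  exact (c.valid ((G.mem_neighborFinset i j).mp hj)).symm

/-- A solution of `Y (k + 2) = A Y (k + 1) - Y k`, for the adjacency matrix `A` of a graph with a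
proper 2-colouring, whose terms live alternately on the two colours. The two colour reflections
shift such a solution; it is the discrete rotation behind the action of a bipartite Coxeter
element. -/
structure IsAlternating (c : G.Coloring Bool) (Y : ℕ → V → ℝ) : Prop where
  add_two : ∀ k, Y (k + 2) = G.adjMatrix ℝ *ᵥ Y (k + 1) - Y k
  eq_zero : ∀ k i, c i ≠ k.bodd → Y k i = 0

theorem isAlternating_of_zero_of_one (hY : ∀ k, Y (k + 2) = G.adjMatrix ℝ *ᵥ Y (k + 1) - Y k)
    (h0 : ∀ i, c i ≠ false → Y 0 i = 0) (h1 : ∀ i, c i ≠ true → Y 1 i = 0) :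
    IsAlternating c Y := by
  refine ⟨hY, fun k => ?_⟩
  induction k using Nat.twoStepInduction with
  | zero => exact h0
  | one => exact h1
  | more k ih0 ih1 =>
    intro i hi
    have hi' : c i = (k + 1).bodd := by rwa [Nat.bodd_succ, Bool.ne_not] at hi
    rw [hY, Pi.sub_apply, adjMatrix_mulVec_eq_zero_of_color ih1 hi',
      ih0 i (by simpa using hi), sub_zero]

theorem IsAlternating.colorReflection_add (hY : IsAlternating c Y) (k : ℕ) :
    colorReflection c k.bodd (Y (k + 1) + Y k) = Y (k + 2) + Y (k + 1) := by
  ext i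
  rw [colorReflection_apply, mulVec_add]
  simp only [Pi.add_apply]
  split_ifs with hi
  · rw [adjMatrix_mulVec_eq_zero_of_color (hY.eq_zero k) hi, hY.add_two,
      hY.eq_zero (k + 1) i (by simp [hi]), Pi.sub_apply]
    ring
  · rw [hY.eq_zero k i hi, hY.eq_zero (k + 2) i (by simpa using hi)]
    ring

theorem IsPerronVector.isAlternating_cos {θ : ℝ} {v : V → ℝ}
    (H : IsPerronVector G (2 * Real.cos θ) v)
    (c : G.Coloring Bool) (δ : ℝ) :
    IsAlternating c fun k i => if c i = k.bodd then Real.cos ((k - δ) * θ) * v i else 0 := by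
  refine ⟨fun k => ?_, fun k i hi => if_neg hi⟩
  have hcos : Real.cos (((k + 2 : ℕ) - δ) * θ) =
      2 * Real.cos θ * Real.cos (((k + 1 : ℕ) - δ) * θ) - Real.cos ((k - δ) * θ) := by
    have := Real.cos_add_cos (((k + 2 : ℕ) - δ) * θ) ((k - δ) * θ)
    push_cast at this ⊢
    ring_nf at this ⊢
    linarith
  ext i
  rw [Pi.sub_apply, G.adjMatrix_mulVec_apply]
  by_cases hi : c i = k.bodd
  · have hsum : ∑ j ∈ G.neighborFinset i, v j = 2 * Real.cos θ * v i := by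
      rw [← G.adjMatrix_mulVec_apply, H.mulVec_eq, Pi.smul_apply, smul_eq_mul]
    have hj {j : V} (hj : j ∈ G.neighborFinset i) : c j = (k + 1).bodd := by
      have := c.valid ((G.mem_neighborFinset i j).mp hj)
      rw [Nat.bodd_succ, ← hi]
      grind
    rw [Finset.sum_congr rfl fun j hj' => if_pos (hj hj'), ← Finset.mul_sum, hsum, if_pos hi,
      if_pos (by simpa using hi), hcos]
    ring
  · have hj {j : V} (hj : j ∈ G.neighborFinset i) : c j ≠ (k + 1).bodd := by
      have := c.valid ((G.mem_neighborFinset i j).mp hj)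
      rw [Nat.bodd_succ]
      grind
    rw [Finset.sum_eq_zero fun j hj' => if_neg (hj hj'), if_neg hi, if_neg (by simpa using hi),
      sub_zero]

variable (G) in
/-- The solution of `Y (k + 2) = A Y (k + 1) - Y k` with `Y 0 = y` and `Y 1 = x`. -/
def chebyshevSeq [DecidableEq V] (x y : V → ℝ) (k : ℕ) : V → ℝ :=
  aeval (G.adjMatrix ℝ) (Chebyshev.S ℝ (k - 1)) *ᵥ x -
    aeval (G.adjMatrix ℝ) (Chebyshev.S ℝ (k - 2)) *ᵥ y

variable [DecidableEq V] {x y : V → ℝ}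

theorem chebyshevSeq_zero : chebyshevSeq G x y 0 = y := by
  simp [chebyshevSeq, Matrix.neg_mulVec]

theorem chebyshevSeq_one : chebyshevSeq G x y 1 = x := by
  simp [chebyshevSeq]

theorem isAlternating_chebyshevSeq (hx : ∀ i, c i ≠ true → x i = 0)
    (hy : ∀ i, c i ≠ false → y i = 0) : IsAlternating c (chebyshevSeq G x y) := by
  refine isAlternating_of_zero_of_one (fun k => ?_) (by rwa [chebyshevSeq_zero])
    (by rwa [chebyshevSeq_one])
  have e1 := Chebyshev.S_add_two ℝ (k - 1)
  have e2 := Chebyshev.S_add_two ℝ (k - 2)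
  simp only [chebyshevSeq]
  push_cast
  rw [show (k : ℤ) + 2 - 1 = k - 1 + 2 by ring, show (k : ℤ) + 2 - 2 = k - 2 + 2 by ring, e1, e2,
    show (k : ℤ) - 1 + 1 = k + 1 - 1 by ring, show (k : ℤ) - 2 + 1 = k + 1 - 2 by ring]
  simp only [map_sub, map_mul, aeval_X, sub_mulVec, mulVec_sub, mulVec_mulVec]
  abel

theorem isAlternating_chebyshevSeq_single {j : V} (hj : c j = true) :
    IsAlternating c (chebyshevSeq G (Pi.single j 1) 0) :=
  isAlternating_chebyshevSeq (fun i hi => Pi.single_eq_of_ne (by rintro rfl; exact hi hj) 1)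
    fun _ _ => rfl

theorem chebyshevSeq_single_apply {i j : V} (k : ℕ) :
    chebyshevSeq G (Pi.single j 1) 0 (k + 1) i =
      aeval (G.adjMatrix ℝ) (Chebyshev.S ℝ k) i j := by
  simp [chebyshevSeq]

theorem chebyshevSeq_zero_add (k : ℕ) : chebyshevSeq G x 0 (k + 1) + chebyshevSeq G x 0 k =
    aeval (G.adjMatrix ℝ) (Chebyshev.S ℝ k + Chebyshev.S ℝ (k - 1)) *ᵥ x := by
  simp [chebyshevSeq, add_mulVec]

theorem chebyshevSeq_two_mul_add {h : ℕ}
    (hA : aeval (G.adjMatrix ℝ) (Chebyshev.S ℝ (h - 1)) = 0) (k : ℕ) :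
    chebyshevSeq G x y (k + 2 * h) = chebyshevSeq G x y k := by
  simp only [chebyshevSeq]
  push_cast
  rw [add_sub_right_comm, add_sub_right_comm, aeval_chebyshevS_add_two_mul hA,
    aeval_chebyshevS_add_two_mul hA]

end AlternatingSequence

section CoxeterElement

variable {V : Type*} [Fintype V] [DecidableEq V] {G : SimpleGraph V} [DecidableRel G.Adj]
  {W : Type*} [Group W] (cs : CoxeterSystem (graphCoxeterMatrix G) W)

theorem geomRep_prod_map_simple_of_color (c : G.Coloring Bool) {b : Bool} {l : List V}
    (hl : l.Nodup) (hmem : ∀ i, i ∈ l ↔ c i = b) :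
    geomRep cs (l.map cs.simple).prod = colorReflection c b := by
  refine LinearMap.ext fun v => funext fun k => ?_
  rw [geomRep_prod_map_simple cs hl, colorReflection_apply]
  · simp only [hmem]
  · intro i hi j hj hij
    exact c.valid hij (((hmem i).mp hi).trans ((hmem j).mp hj).symm)

theorem exists_geomRep_eq_colorReflection (c : G.Coloring Bool) (b : Bool) :
    ∃ w, geomRep cs w = colorReflection c b :=
  ⟨_, geomRep_prod_map_simple_of_color cs c (Finset.univ.filter fun i => c i = b).nodup_toList
    fun i => by simp⟩

theorem IsAlternating.exists_geomRep_eq {c : G.Coloring Bool} {Y : ℕ → V → ℝ}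
    (hY : IsAlternating c Y) (k : ℕ) :
    ∃ w, geomRep cs w (Y 1 + Y 0) = Y (k + 1) + Y k := by
  induction k with
  | zero => exact ⟨1, by simp⟩
  | succ k ih =>
    obtain ⟨w, hw⟩ := ih
    obtain ⟨u, hu⟩ := exists_geomRep_eq_colorReflection cs c k.bodd
    exact ⟨u * w, by rw [map_mul, Module.End.mul_apply, hw, hu, hY.colorReflection_add]⟩

theorem geomRep_single_nonneg_of_dotProduct_pos {v : V → ℝ} (hv : 0 ≤ v) {w : W} {j : V}
    (h : 0 < v ⬝ᵥ geomRep cs w (Pi.single j 1)) : 0 ≤ geomRep cs w (Pi.single j 1) :=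
  (geomRep_single_nonneg_or_nonpos cs w j).resolve_right fun hw =>
    h.not_ge (Finset.sum_nonpos fun i _ => mul_nonpos_of_nonneg_of_nonpos (hv i) (hw i))

variable {h : ℕ} {v : V → ℝ}

namespace IsPerronVector

theorem aeval_chebyshevS_nonneg (H : IsPerronVector G (2 * Real.cos (Real.pi / h)) v) (hh : 2 ≤ h)
    (c : G.Coloring Bool) {k : ℕ} (hk : k < h) (i j : V) :
    0 ≤ aeval (G.adjMatrix ℝ) (Chebyshev.S ℝ k) i j := by
  obtain ⟨c, hc⟩ := exists_coloring_eq_true c j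
  have hY := isAlternating_chebyshevSeq_single hc
  -- `(S_k + S_{k-1})(A) α_j` is a root; as it pairs positively with `v`, it is a positive root.
  obtain ⟨w, hw⟩ := hY.exists_geomRep_eq (graphCoxeterMatrix G).toCoxeterSystem k
  rw [chebyshevSeq_zero, chebyshevSeq_one, add_zero] at hw
  have hpos : 0 < v ⬝ᵥ geomRep (graphCoxeterMatrix G).toCoxeterSystem w (Pi.single j 1) := by
    have hS : 0 < (Chebyshev.S ℝ k + Chebyshev.S ℝ (k - 1)).eval (2 * Real.cos (Real.pi / h)) := by
      rw [eval_add]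
      cases k with
      | zero => simp
      | succ k =>
        rw [Nat.cast_succ, add_sub_cancel_right, ← Nat.cast_succ]
        exact add_pos_of_nonneg_of_pos (eval_chebyshevS_nonneg hk hh) (eval_chebyshevS_pos hk)
    rw [hw, chebyshevSeq_zero_add, dotProduct_mulVec, ← mulVec_transpose,
      isSymm_aeval G.isSymm_adjMatrix, aeval_mulVec_of_mulVec_eq_smul H.mulVec_eq,
      dotProduct_single_one, Pi.smul_apply, smul_eq_mul]
    exact mul_pos hS (H.pos j)
  have hroot := geomRep_single_nonneg_of_dotProduct_pos _ (fun i => (H.pos i).le) hpos i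
  rw [hw, Pi.add_apply] at hroot
  rw [← chebyshevSeq_single_apply]
  by_cases hi : c i = k.bodd
  · exact (hY.eq_zero (k + 1) i (by simp [hi])).ge
  · rwa [hY.eq_zero k i hi, add_zero] at hroot

theorem aeval_chebyshevS_sub_one_eq_zero (H : IsPerronVector G (2 * Real.cos (Real.pi / h)) v)
    (hh : 2 ≤ h) (c : G.Coloring Bool) :
    aeval (G.adjMatrix ℝ) (Chebyshev.S ℝ (h - 1)) = 0 := by
  have hv := aeval_mulVec_of_mulVec_eq_smul H.mulVec_eq (Chebyshev.S ℝ (h - 1))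
  rw [eval_chebyshevS_sub_one_eq_zero hh, zero_smul] at hv
  have hnonneg := H.aeval_chebyshevS_nonneg hh c (k := h - 1) (by omega)
  rw [Nat.cast_pred (by omega)] at hnonneg
  ext i j
  have hsum := congrFun hv i
  have := (Finset.sum_eq_zero_iff_of_nonneg fun j _ =>
    mul_nonneg (hnonneg i j) (H.pos j).le).mp hsum j (Finset.mem_univ j)
  exact (mul_eq_zero_iff_right (H.pos j).ne').mp this

end IsPerronVector

variable {c : G.Coloring Bool} {r : Bool → W}
  (hr : ∀ b, geomRep cs (r b) = colorReflection c b)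

include hr

theorem IsAlternating.geomRep_pow {Y : ℕ → V → ℝ} (hY : IsAlternating c Y) (k : ℕ) :
    geomRep cs ((r true * r false) ^ k) (Y 1 + Y 0) = Y (2 * k + 1) + Y (2 * k) := by
  induction k with
  | zero => simp
  | succ k ih =>
    have h0 := hY.colorReflection_add (2 * k)
    have h1 := hY.colorReflection_add (2 * k + 1)
    rw [Nat.bodd_add, Nat.bodd_mul] at h1
    rw [Nat.bodd_mul] at h0
    rw [pow_succ', map_mul, Module.End.mul_apply, ih, map_mul, Module.End.mul_apply, hr, hr]
    exact (congrArg _ h0).trans h1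

theorem pow_eq_one_of_aeval_chebyshevS_eq_zero
    (hA : aeval (G.adjMatrix ℝ) (Chebyshev.S ℝ (h - 1)) = 0) : (r true * r false) ^ h = 1 := by
  refine geomRep_injective cs (LinearMap.ext fun v => ?_)
  let x : V → ℝ := fun i => if c i then v i else 0
  let y : V → ℝ := fun i => if c i then 0 else v i
  have hxy : x + y = v := by
    ext i
    cases hi : c i <;> simp [x, y, hi]
  have hY : IsAlternating c (chebyshevSeq G x y) :=
    isAlternating_chebyshevSeq (by simp +contextual [x]) (by simp +contextual [y])
  have hpow := hY.geomRep_pow cs hr h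
  rw [add_comm (2 * h), chebyshevSeq_two_mul_add hA, ← zero_add (2 * h),
    chebyshevSeq_two_mul_add hA, chebyshevSeq_zero, chebyshevSeq_one, hxy] at hpow
  rwa [map_one, Module.End.one_apply]

theorem IsPerronVector.dvd_of_pow_eq_one [Nonempty V]
    (H : IsPerronVector G (2 * Real.cos (Real.pi / h)) v) (hh : h ≠ 0) {k : ℕ}
    (hk : (r true * r false) ^ k = 1) : h ∣ k := by
  have hh' : (h : ℝ) ≠ 0 := Nat.cast_ne_zero.mpr hh
  obtain ⟨i⟩ := ‹Nonempty V›
  have hpow := congrFun ((H.isAlternating_cos c (c i).toNat).geomRep_pow cs hr k) i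
  have hcos : Real.cos (2 * k * (Real.pi / h)) = 1 := by
    rw [hk] at hpow
    refine mul_right_cancel₀ (H.pos i).ne' ?_
    cases hi : c i <;> simpa [hi, Nat.bodd_mul] using hpow.symm
  obtain ⟨n, hn⟩ := (Real.cos_eq_one_iff _).mp hcos
  refine Int.natCast_dvd_natCast.mp ⟨n, ?_⟩
  field_simp at hn
  rw [mul_comm]
  exact_mod_cast hn.symm

theorem IsPerronVector.orderOf_eq [Nonempty V]
    (H : IsPerronVector G (2 * Real.cos (Real.pi / h)) v) (hh : 2 ≤ h) :
    orderOf (r true * r false) = h :=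
  Nat.dvd_antisymm
    (orderOf_dvd_of_pow_eq_one (pow_eq_one_of_aeval_chebyshevS_eq_zero cs hr
      (H.aeval_chebyshevS_sub_one_eq_zero hh c)))
    (H.dvd_of_pow_eq_one cs hr (by omega) (pow_orderOf_eq_one _))

end CoxeterElement

section ChebyshevReal

theorem eval_chebyshevS_add_two_add (t : ℝ) (k : ℤ) :
    (Chebyshev.S ℝ (k + 2)).eval t + (Chebyshev.S ℝ k).eval t =
      t * (Chebyshev.S ℝ (k + 1)).eval t := by
  simp [Chebyshev.S_add_two]

theorem eval_chebyshevS_sub_two_sub {h : ℕ} (hh : 2 ≤ h) (k : ℤ) :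
    (Chebyshev.S ℝ (h - 2 - k)).eval (2 * Real.cos (Real.pi / h)) =
      (Chebyshev.S ℝ k).eval (2 * Real.cos (Real.pi / h)) := by
  have hh' : (h : ℝ) ≠ 0 := Nat.cast_ne_zero.mpr (by omega)
  refine mul_right_cancel₀ (sin_pi_div_pos hh).ne' ?_
  rw [Chebyshev.S_two_mul_real_cos, Chebyshev.S_two_mul_real_cos, ← Real.sin_pi_sub]
  congr 1
  push_cast
  field_simp
  ring

theorem eval_chebyshevS_branch {h : ℕ} (hh : 2 ≤ h) {b : ℤ}
    (hb : Real.sin ((b + 5) * (Real.pi / h)) =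
      Real.sin ((b + 1) * (Real.pi / h)) + Real.sin ((b - 1) * (Real.pi / h))) :
    ((2 * Real.cos (Real.pi / h)) ^ 2 - 1) *
        (Chebyshev.S ℝ (b + 2)).eval (2 * Real.cos (Real.pi / h)) =
      (2 * Real.cos (Real.pi / h)) ^ 2 * (Chebyshev.S ℝ b).eval (2 * Real.cos (Real.pi / h)) := by
  set t := 2 * Real.cos (Real.pi / h) with ht
  have key : (Chebyshev.S ℝ (b + 4)).eval t =
      (Chebyshev.S ℝ b).eval t + (Chebyshev.S ℝ (b - 2)).eval t := by
    refine mul_right_cancel₀ (sin_pi_div_pos hh).ne' ?_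
    rw [add_mul]
    simp only [ht, Chebyshev.S_two_mul_real_cos]
    push_cast
    ring_nf at hb ⊢
    exact hb
  have e0 := eval_chebyshevS_add_two_add t (b - 2)
  have e1 := eval_chebyshevS_add_two_add t (b - 1)
  have e3 := eval_chebyshevS_add_two_add t (b + 1)
  have e4 := eval_chebyshevS_add_two_add t (b + 2)
  ring_nf at key e0 e1 e3 e4 ⊢
  linear_combination key + e0 + t * e1 - t * e3 - e4

end ChebyshevReal

namespace ADEDiagram

variable {Γ : ADEDiagram}

theorem Edge.lt {i j : ℕ} (h : Γ.Edge i j) : i < j := by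
  cases Γ <;> simp only [Edge] at h <;> omega

theorem Edge.le_rank {i j : ℕ} (h : Γ.Edge i j) (hi : i < Γ.rank) : j ≤ Γ.rank := by
  cases Γ <;> simp only [Edge, rank] at h hi ⊢ <;> omega

theorem exists_edge {j : ℕ} (hj : j ≠ 0) : ∃ i, Γ.Edge i j := by
  obtain ⟨k, rfl⟩ := Nat.exists_eq_succ_of_ne_zero hj
  by_cases hk : Γ.Edge k (k + 1)
  · exact ⟨k, hk⟩
  · cases Γ <;> simp only [Edge, true_and, not_true_eq_false] at hk ⊢
    · exact ⟨1, by omega⟩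
    · exact ⟨2, by omega⟩
    · exact ⟨3, by omega⟩
    · exact ⟨4, by omega⟩

theorem graph_adj {i j : Fin Γ.rank} : Γ.graph.Adj i j ↔ Γ.Edge i j ∨ Γ.Edge j i := by
  rw [graph, SimpleGraph.fromRel_adj, and_iff_right_of_imp]
  rintro (h | h) rfl <;> exact h.lt.ne rfl

theorem connected_graph (Γ : ADEDiagram) : Γ.graph.Connected := by
  have hroot (n : ℕ) (hn : n < Γ.rank) : Γ.graph.Reachable ⟨n, hn⟩ Γ.root := by
    induction n using Nat.strong_induction_on with
    | _ n ih =>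
    rcases eq_or_ne n 0 with rfl | hn0
    · exact .rfl
    · obtain ⟨i, hi⟩ := Γ.exists_edge hn0
      have hin : Γ.graph.Adj ⟨n, hn⟩ ⟨i, hi.lt.trans hn⟩ := graph_adj.mpr (.inr hi)
      exact hin.reachable.trans (ih i hi.lt _)
  have : Nonempty (Fin Γ.rank) := ⟨Γ.root⟩
  exact .mk fun i j => (hroot i i.2).trans (hroot j j.2).symm

theorem exists_bool_ne_of_edge (Γ : ADEDiagram) :
    ∃ c : ℕ → Bool, ∀ i j, Γ.Edge i j → c i ≠ c j := by
  cases Γ with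
  | D n hn =>
    refine ⟨fun j => decide ((j % 2 = 0) ↔ (j < 3)), fun i j hij => ?_⟩
    simp only [Edge] at hij
    rw [ne_eq, decide_eq_decide]
    omega
  | _ =>
    refine ⟨fun j => decide (j % 2 = 0), fun i j hij => ?_⟩
    simp only [Edge] at hij
    rw [ne_eq, decide_eq_decide]
    omega

theorem exists_coloring_root (Γ : ADEDiagram) : ∃ c : Γ.graph.Coloring Bool, c Γ.root = true := by
  obtain ⟨c, hc⟩ := Γ.exists_bool_ne_of_edge
  refine exists_coloring_eq_true (.mk (fun i : Fin Γ.rank => c i) fun {i j} hij => ?_) Γ.root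
  exact (graph_adj.mp hij).elim (hc i j) fun h => (hc j i h).symm

theorem adjMatrix_mulVec_apply_eq_sum {f : ℕ → ℝ} (hf : f Γ.rank = 0) (i : Fin Γ.rank)
    {s : Finset ℕ} (hs : ∀ j, j ∈ s ↔ Γ.Edge i j ∨ Γ.Edge j i) :
    (Γ.graph.adjMatrix ℝ *ᵥ fun j => f j) i = ∑ j ∈ s, f j := by
  have hle : ∀ j ∈ s, j ∈ Finset.range (Γ.rank + 1) := fun j hj => by
    rw [Finset.mem_range_succ_iff]
    exact ((hs j).mp hj).elim (fun h => h.le_rank i.2) fun h => (h.lt.trans i.2).le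
  calc (Γ.graph.adjMatrix ℝ *ᵥ fun j => f j) i
      = ∑ j : Fin Γ.rank, if (j : ℕ) ∈ s then f j else 0 := by
        simp only [mulVec, dotProduct, SimpleGraph.adjMatrix_apply, ite_mul, one_mul, zero_mul,
          hs, graph_adj]
    _ = ∑ j ∈ Finset.range (Γ.rank + 1), if j ∈ s then f j else 0 := by
        rw [Fin.sum_univ_eq_sum_range fun j => if j ∈ s then f j else 0, Finset.sum_range_succ,
          hf, ite_self, add_zero]
    _ = ∑ j ∈ s, f j := by rw [← Finset.sum_filter, Finset.filter_mem_eq_inter,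
        Finset.inter_eq_right.mpr hle]

theorem isPerronVector_of_sum {t : ℝ} {f : ℕ → ℝ} (hpos : ∀ i < Γ.rank, 0 < f i)
    (hf : f Γ.rank = 0) (hsum : ∀ i < Γ.rank,
      ∃ s : Finset ℕ, (∀ j, j ∈ s ↔ Γ.Edge i j ∨ Γ.Edge j i) ∧ ∑ j ∈ s, f j = t * f i) :
    IsPerronVector Γ.graph t fun j => f j := by
  refine ⟨fun i => hpos i i.2, funext fun i => ?_⟩
  obtain ⟨s, hs, hs'⟩ := hsum i i.2
  rw [adjMatrix_mulVec_apply_eq_sum hf i hs, hs', Pi.smul_apply, smul_eq_mul]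

theorem isPerronVector_A (n : ℕ) (hn : 1 ≤ n) :
    IsPerronVector (A n hn).graph (2 * Real.cos (Real.pi / (n + 1 : ℕ)))
      fun j => (Chebyshev.S ℝ (j : ℕ)).eval (2 * Real.cos (Real.pi / (n + 1 : ℕ))) := by
  refine isPerronVector_of_sum (f := fun j => (Chebyshev.S ℝ (j : ℤ)).eval _)
    (fun i hi => eval_chebyshevS_pos (Nat.succ_lt_succ hi)) ?_ fun i hi => ?_
  · simpa [rank] using eval_chebyshevS_sub_one_eq_zero (h := n + 1) (by omega)
  · cases i with
    | zero => exact ⟨{1}, by simp [Edge], by simp⟩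
    | succ i =>
      refine ⟨{i + 2, i}, fun j => by simp [Edge]; omega, ?_⟩
      rw [Finset.sum_pair (by omega)]
      exact_mod_cast eval_chebyshevS_add_two_add _ i

/-- The Perron eigenvector of `D_{m+3}`. The branch vertex `1` and the long branch `3, 4, …`
carry the Chebyshev values, counted from the far end. -/
def perronD (m : ℕ) (t : ℝ) : ℕ → ℝ
  | 0 | 2 => (Chebyshev.S ℝ (m + 1)).eval t / 2
  | 1 => (Chebyshev.S ℝ m).eval t
  | j + 3 => (Chebyshev.S ℝ (m - 1 - j)).eval t

theorem isPerronVector_D (m : ℕ) (hm : 4 ≤ m + 3) :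
    IsPerronVector (D (m + 3) hm).graph (2 * Real.cos (Real.pi / (2 * m + 4 : ℕ)))
      fun j => perronD m (2 * Real.cos (Real.pi / (2 * m + 4 : ℕ))) j := by
  set t := 2 * Real.cos (Real.pi / (2 * m + 4 : ℕ))
  have hS {k : ℕ} (hk : k ≤ m + 1) : 0 < (Chebyshev.S ℝ k).eval t :=
    eval_chebyshevS_pos (by omega)
  have hleaf : (Chebyshev.S ℝ m).eval t = t * ((Chebyshev.S ℝ (m + 1)).eval t / 2) := by
    have hrec := eval_chebyshevS_add_two_add t m
    have hreflect := eval_chebyshevS_sub_two_sub (h := 2 * m + 4) (by omega) m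
    rw [show ((2 * m + 4 : ℕ) - 2 - m : ℤ) = m + 2 by push_cast; ring] at hreflect
    linarith
  refine isPerronVector_of_sum (fun i hi => ?_) ?_ fun i hi => ?_
  · match i with
    | 0 | 2 => exact half_pos (by exact_mod_cast hS le_rfl)
    | 1 => exact hS (by omega)
    | j + 3 =>
      have hj : j + 3 < m + 3 := hi
      have := hS (k := m - 1 - j) (by omega)
      rwa [Nat.cast_sub (by omega), Nat.cast_pred (by omega)] at this
  · simp [rank, perronD]
  · match i with
    | 0 => exact ⟨{1}, fun j => by simp [Edge]; omega, by simpa [perronD] using hleaf⟩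
    | 1 =>
      refine ⟨{0, 2, 3}, fun j => by simp [Edge]; omega, ?_⟩
      rw [Finset.sum_insert (by simp), Finset.sum_pair (by omega)]
      simp only [perronD]
      linear_combination (norm := (push_cast; ring_nf)) eval_chebyshevS_add_two_add t (m - 1)
    | 2 => exact ⟨{1}, fun j => by simp [Edge], by simpa [perronD] using hleaf⟩
    | 3 =>
      refine ⟨{1, 4}, fun j => by simp [Edge]; omega, ?_⟩
      rw [Finset.sum_pair (by omega)]
      simp only [perronD]
      linear_combination (norm := (push_cast; ring_nf)) eval_chebyshevS_add_two_add t (m - 2)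
    | j + 4 =>
      refine ⟨{j + 3, j + 5}, fun k => by simp [Edge]; omega, ?_⟩
      rw [Finset.sum_pair (by omega)]
      simp only [perronD]
      linear_combination (norm := (push_cast; ring_nf)) eval_chebyshevS_add_two_add t (m - 3 - j)

/-- The Perron eigenvector of `E_{b+4}`, where `b` is the branch vertex and `b + 3` its leaf. -/
def perronE (b : ℕ) (t : ℝ) (j : ℕ) : ℝ :=
  if j ≤ b then t * (t ^ 2 - 1) * (Chebyshev.S ℝ j).eval t
  else if j = b + 1 then t ^ 2 * (Chebyshev.S ℝ b).eval t
  else if j = b + 2 then t * (Chebyshev.S ℝ b).eval t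
  else if j = b + 3 then (t ^ 2 - 1) * (Chebyshev.S ℝ b).eval t
  else 0

theorem perronE_of_le {b j : ℕ} (t : ℝ) (hj : j ≤ b) :
    perronE b t j = t * (t ^ 2 - 1) * (Chebyshev.S ℝ j).eval t :=
  if_pos hj

theorem perronE_add_one (b : ℕ) (t : ℝ) :
    perronE b t (b + 1) = t ^ 2 * (Chebyshev.S ℝ b).eval t := by
  simp [perronE]

theorem perronE_add_two (b : ℕ) (t : ℝ) :
    perronE b t (b + 2) = t * (Chebyshev.S ℝ b).eval t := by
  simp [perronE]

theorem perronE_add_three (b : ℕ) (t : ℝ) :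
    perronE b t (b + 3) = (t ^ 2 - 1) * (Chebyshev.S ℝ b).eval t := by
  simp [perronE]

theorem perronE_add_four (b : ℕ) (t : ℝ) : perronE b t (b + 4) = 0 := by
  simp [perronE]

theorem perronE_pos {b i : ℕ} {t : ℝ} (ht : 0 < t) (ht' : 0 < t ^ 2 - 1)
    (hS : ∀ k ≤ b, 0 < (Chebyshev.S ℝ k).eval t) (hi : i < b + 4) : 0 < perronE b t i := by
  have hSb := hS b le_rfl
  obtain hi | rfl | rfl | rfl : i ≤ b ∨ i = b + 1 ∨ i = b + 2 ∨ i = b + 3 := by omega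
  · have := hS i hi
    rw [perronE_of_le t hi]
    positivity
  · rw [perronE_add_one]
    positivity
  · rw [perronE_add_two]
    positivity
  · rw [perronE_add_three]
    positivity

theorem exists_sum_perronE_eq {b i : ℕ} {t : ℝ} (hb : b ≠ 0)
    (hbranch : (t ^ 2 - 1) * (Chebyshev.S ℝ (b + 2)).eval t = t ^ 2 * (Chebyshev.S ℝ b).eval t)
    (hedge : ∀ i j, Γ.Edge i j ↔ (j = i + 1 ∧ j ≠ b + 3) ∨ (i = b ∧ j = b + 3))
    (hi : i < b + 4) : ∃ s : Finset ℕ, (∀ j, j ∈ s ↔ Γ.Edge i j ∨ Γ.Edge j i) ∧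
      ∑ j ∈ s, perronE b t j = t * perronE b t i := by
  have hrec (k : ℕ) := eval_chebyshevS_add_two_add t k
  obtain hi | rfl | rfl | rfl | rfl :
    i < b ∨ b = i ∨ i = b + 1 ∨ i = b + 2 ∨ i = b + 3 := by omega
  · cases i with
    | zero =>
      refine ⟨{1}, fun j => by simp [hedge]; omega, ?_⟩
      rw [Finset.sum_singleton, perronE_of_le t hi, perronE_of_le t hi.le]
      simp only [Nat.cast_zero, Nat.cast_one, Chebyshev.S_one, Chebyshev.S_zero,
        eval_X, eval_one]
      ring
    | succ i =>
      refine ⟨{i + 2, i}, fun j => by simp [hedge]; omega, ?_⟩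
      rw [Finset.sum_pair (by omega), perronE_of_le t (show i + 2 ≤ b from hi),
        perronE_of_le t hi.le, perronE_of_le t (by omega)]
      push_cast
      linear_combination t * (t ^ 2 - 1) * hrec i
  · obtain ⟨k, rfl⟩ := Nat.exists_eq_add_one_of_ne_zero hb
    refine ⟨{k, k + 1 + 1, k + 1 + 3}, fun j => by simp [hedge]; omega, ?_⟩
    rw [Finset.sum_insert (by simp; omega), Finset.sum_pair (by omega),
      perronE_of_le t k.le_succ,
      perronE_of_le t le_rfl, perronE_add_one, perronE_add_three]
    have hrec_k := hrec k
    have hrec_succ := hrec (k + 1)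
    push_cast at hbranch hrec_succ ⊢
    ring_nf at hbranch hrec_k hrec_succ ⊢
    linear_combination t * (t ^ 2 - 1) * hrec_k + (t ^ 2 - 1) * hrec_succ - hbranch
  · refine ⟨{b, b + 2}, fun j => by simp [hedge]; omega, ?_⟩
    rw [Finset.sum_pair (by omega), perronE_of_le t le_rfl, perronE_add_one, perronE_add_two]
    ring
  · refine ⟨{b + 1}, fun j => by simp [hedge]; omega, ?_⟩
    rw [Finset.sum_singleton, perronE_add_one, perronE_add_two]
    ring
  · refine ⟨{b, b + 4}, fun j => by simp [hedge]; omega, ?_⟩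
    rw [Finset.sum_pair (by omega), perronE_of_le t le_rfl, perronE_add_three, perronE_add_four]
    ring

theorem isPerronVector_E {b h : ℕ} (hb : 2 ≤ b) (hh : b + 1 < h) (hr : Γ.rank = b + 4)
    (hedge : ∀ i j, Γ.Edge i j ↔ (j = i + 1 ∧ j ≠ b + 3) ∨ (i = b ∧ j = b + 3))
    (hsin : Real.sin ((b + 5) * (Real.pi / h)) =
      Real.sin ((b + 1) * (Real.pi / h)) + Real.sin ((b - 1) * (Real.pi / h))) :
    IsPerronVector Γ.graph (2 * Real.cos (Real.pi / h))
      fun j => perronE b (2 * Real.cos (Real.pi / h)) j := by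
  have hS (k : ℕ) (hk : k ≤ b) := eval_chebyshevS_pos (h := h) (k := k) (by omega)
  have hbranch := eval_chebyshevS_branch (b := b) (h := h) (by omega) (by exact_mod_cast hsin)
  refine isPerronVector_of_sum (fun i hi => perronE_pos ?_ ?_ hS (hr ▸ hi))
    (hr ▸ perronE_add_four b _) fun i hi => exists_sum_perronE_eq (by omega) hbranch hedge (hr ▸ hi)
  · simpa using hS 1 (by omega)
  · simpa [Chebyshev.S_two] using hS 2 hb

theorem isPerronVector_E6 : IsPerronVector E6.graph (2 * Real.cos (Real.pi / (12 : ℕ)))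
    fun j => perronE 2 (2 * Real.cos (Real.pi / (12 : ℕ))) j := by
  refine isPerronVector_E le_rfl (by norm_num) rfl (fun _ _ => Iff.rfl) ?_
  have := Real.sin_sub_sin (7 * (Real.pi / 12)) (Real.pi / 12)
  rw [show (7 * (Real.pi / 12) + Real.pi / 12) / 2 = Real.pi / 3 by ring,
    Real.cos_pi_div_three] at this
  push_cast
  ring_nf at this ⊢
  linarith

theorem isPerronVector_E7 : IsPerronVector E7.graph (2 * Real.cos (Real.pi / (18 : ℕ)))
    fun j => perronE 3 (2 * Real.cos (Real.pi / (18 : ℕ))) j := by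
  refine isPerronVector_E (by norm_num) (by norm_num) rfl (fun _ _ => Iff.rfl) ?_
  have hsum := Real.sin_add_sin (4 * (Real.pi / 18)) (2 * (Real.pi / 18))
  have hcompl := Real.sin_pi_div_two_sub (Real.pi / 18)
  rw [show (4 * (Real.pi / 18) + 2 * (Real.pi / 18)) / 2 = Real.pi / 6 by ring,
    Real.sin_pi_div_six] at hsum
  push_cast
  ring_nf at hsum hcompl ⊢
  linarith

theorem isPerronVector_E8 : IsPerronVector E8.graph (2 * Real.cos (Real.pi / (30 : ℕ)))
    fun j => perronE 4 (2 * Real.cos (Real.pi / (30 : ℕ))) j := by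
  refine isPerronVector_E (by norm_num) (by norm_num) rfl (fun _ _ => Iff.rfl) ?_
  have hcompl := Real.sin_pi_div_two_sub (Real.pi / 5)
  have hcompl_two := Real.sin_pi_div_two_sub (2 * (Real.pi / 5))
  have hdouble := Real.cos_two_mul (Real.pi / 5)
  have hsixth := Real.sin_pi_div_six
  have hfifth : Real.cos (Real.pi / 5) - Real.cos (2 * (Real.pi / 5)) = 1 / 2 := by
    rw [hdouble, Real.cos_pi_div_five]
    ring_nf
    norm_num
  push_cast
  ring_nf at hcompl hcompl_two hsixth hfifth ⊢
  linarith

theorem exists_isPerronVector (Γ : ADEDiagram) :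
    ∃ h v, 2 ≤ h ∧ IsPerronVector Γ.graph (2 * Real.cos (Real.pi / (h : ℕ))) v := by
  cases Γ with
  | A n hn => exact ⟨_, _, by omega, isPerronVector_A n hn⟩
  | D n hn =>
    obtain ⟨m, rfl⟩ := Nat.exists_eq_add_of_le' (show 3 ≤ n by omega)
    exact ⟨_, _, by omega, isPerronVector_D m hn⟩
  | E6 => exact ⟨_, _, by norm_num, isPerronVector_E6⟩
  | E7 => exact ⟨_, _, by norm_num, isPerronVector_E7⟩
  | E8 => exact ⟨_, _, by norm_num, isPerronVector_E8⟩

end ADEDiagram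

namespace ADEDiagram

variable (Γ : ADEDiagram)

theorem even_dist_root_iff {c : Γ.graph.Coloring Bool} (hc : c Γ.root = true) (k : Fin Γ.rank) :
    Even (Γ.graph.dist k Γ.root) ↔ c k = true := by
  obtain ⟨p, hp⟩ := Γ.connected_graph.exists_walk_length_eq_dist k Γ.root
  rw [← hp, c.even_length_iff_congr, iff_true_right hc]

theorem coxeterNumber_eq {h : ℕ} (hh : 2 ≤ h) {v : Γ.V}
    (H : IsPerronVector Γ.graph (2 * Real.cos (Real.pi / h)) v) : Γ.coxeterNumber = h := by
  obtain ⟨c, hc⟩ := Γ.exists_coloring_root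
  have : Nonempty (Fin Γ.rank) := ⟨Γ.root⟩
  let cs : CoxeterSystem (graphCoxeterMatrix Γ.graph) Γ.W := Γ.coxeterMatrix.toCoxeterSystem
  have hr (b : Bool) : geomRep cs (cond b Γ.gammaPlus Γ.gammaMinus) = colorReflection c b := by
    cases b
    · exact geomRep_prod_map_simple_of_color cs c ((List.nodup_finRange _).filter _) fun k => by
        simp [← Nat.not_even_iff_odd, Γ.even_dist_root_iff hc]
    · exact geomRep_prod_map_simple_of_color cs c ((List.nodup_finRange _).filter _) fun k => by
        simp [Γ.even_dist_root_iff hc]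
  exact H.orderOf_eq cs hr hh

theorem two_le_coxeterNumber : 2 ≤ Γ.coxeterNumber := by
  obtain ⟨h, v, hh, H⟩ := Γ.exists_isPerronVector
  rwa [Γ.coxeterNumber_eq hh H]

theorem exists_isPerronVector_coxeterNumber :
    ∃ v, IsPerronVector Γ.graph (2 * Real.cos (Real.pi / Γ.coxeterNumber)) v := by
  obtain ⟨h, v, hh, H⟩ := Γ.exists_isPerronVector
  exact ⟨v, by rwa [Γ.coxeterNumber_eq hh H]⟩

theorem two_smul_one_sub_cartanMatrix :
    (2 : ℝ) • (1 : Matrix (Fin Γ.rank) (Fin Γ.rank) ℝ) - Γ.cartanMatrix =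
      Γ.graph.adjMatrix ℝ := by
  ext i j
  by_cases hij : i = j
  · subst hij
    simp [cartanMatrix]
  · by_cases hadj : Γ.graph.Adj i j <;> simp [cartanMatrix, coxeterMatrix, hij, hadj]

theorem eigenspace_eq (t : ℝ) :
    Γ.eigenspace t = Module.End.eigenspace (toLin' (Γ.graph.adjMatrix ℝ)) t := by
  rw [eigenspace, two_smul_one_sub_cartanMatrix]

theorem finrank_eigenspace :
    Module.finrank ℝ (Γ.eigenspace (2 * Real.cos (Real.pi / Γ.coxeterNumber))) = 1 := by
  obtain ⟨v, H⟩ := Γ.exists_isPerronVector_coxeterNumber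
  rw [eigenspace_eq, H.finrank_eigenspace Γ.connected_graph]

theorem finrank_eigenspace_neg :
    Module.finrank ℝ (Γ.eigenspace (-(2 * Real.cos (Real.pi / Γ.coxeterNumber)))) = 1 := by
  obtain ⟨c, -⟩ := Γ.exists_coloring_root
  rw [eigenspace_eq, _root_.finrank_eigenspace_neg c, ← eigenspace_eq, finrank_eigenspace]

theorem finrank_coxeterPlane (hn : 2 ≤ Γ.rank) : Module.finrank ℝ Γ.coxeterPlane = 2 := by
  obtain ⟨c, -⟩ := Γ.exists_coloring_root
  obtain ⟨v, H⟩ := Γ.exists_isPerronVector_coxeterNumber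
  have : Nontrivial (Fin Γ.rank) := Fin.nontrivial_iff_two_le.mpr hn
  rw [coxeterPlane, eigenspace_eq, eigenspace_eq, H.finrank_eigenspace_sup Γ.connected_graph c]

theorem mem_coxeterPlane_iff {w : Γ.V} :
    w ∈ Γ.coxeterPlane ↔ Γ.graph.adjMatrix ℝ ^ 2 *ᵥ w =
      (2 * Real.cos (Real.pi / Γ.coxeterNumber)) ^ 2 • w := by
  rw [coxeterPlane, eigenspace_eq, eigenspace_eq,
    eigenspace_sup_eigenspace_neg Γ.graph.isSymm_adjMatrix, mem_eigenspace_toLin'_iff]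

end ADEDiagram

section NonnegativeMatrix

variable {I : Type*} [Fintype I] [DecidableEq I]

theorem hasEigenvalue_toLin'_of_vecMul_eq_smul {K : Type*} [Field K] {N : Matrix I I K}
    {d : I → K} {r : K} (hd : d ≠ 0) (hdN : d ᵥ* N = r • d) :
    Module.End.HasEigenvalue (toLin' N) r := by
  have hker : d ᵥ* (N - r • (1 : Matrix I I K)) = 0 := by
    rw [vecMul_sub, hdN, vecMul_smul, vecMul_one, sub_self]
  obtain ⟨w, hw, hNw⟩ :=
    exists_mulVec_eq_zero_iff.mpr (exists_vecMul_eq_zero_iff.mp ⟨d, hd, hker⟩)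
  rw [sub_mulVec, smul_mulVec, one_mulVec, sub_eq_zero] at hNw
  exact Module.End.hasEigenvalue_of_hasEigenvector (x := w)
    ⟨mem_eigenspace_toLin'_iff.mpr hNw, hw⟩

theorem le_of_hasEigenvalue_of_vecMul_eq_smul {N : Matrix I I ℝ} (hN : ∀ k j, 0 ≤ N k j)
    {d : I → ℝ} (hd : ∀ k, 0 < d k) {r t : ℝ} (hdN : d ᵥ* N = r • d)
    (ht : Module.End.HasEigenvalue (toLin' N) t) : t ≤ r := by
  obtain ⟨w, hw, hw0⟩ := ht.exists_hasEigenvector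
  rw [mem_eigenspace_toLin'_iff] at hw
  have hpos : 0 < ∑ k, d k * |w k| := by
    obtain ⟨k, hk⟩ := Function.ne_iff.mp hw0
    exact Finset.sum_pos' (fun k _ => mul_nonneg (hd k).le (abs_nonneg _))
      ⟨k, Finset.mem_univ k, mul_pos (hd k) (abs_pos.mpr hk)⟩
  have habs (k : I) : t * |w k| ≤ (N *ᵥ fun j => |w j|) k :=
    calc t * |w k| ≤ |t| * |w k| := mul_le_mul_of_nonneg_right (le_abs_self t) (abs_nonneg _)
      _ = |∑ j, N k j * w j| := by rw [← abs_mul]; exact congrArg abs (congrFun hw k).symm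
      _ ≤ ∑ j, |N k j * w j| := Finset.abs_sum_le_sum_abs _ _
      _ = ∑ j, N k j * |w j| := by simp only [abs_mul, abs_of_nonneg (hN k _)]
  refine le_of_mul_le_mul_right ?_ hpos
  calc t * ∑ k, d k * |w k| = ∑ k, d k * (t * |w k|) := by
        rw [Finset.mul_sum]
        exact Finset.sum_congr rfl fun k _ => mul_left_comm _ _ _
    _ ≤ d ⬝ᵥ (N *ᵥ fun j => |w j|) :=
        Finset.sum_le_sum fun k _ => mul_le_mul_of_nonneg_left (habs k) (hd k).le
    _ = r * ∑ k, d k * |w k| := by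
        rw [dotProduct_mulVec, hdN, smul_dotProduct, smul_eq_mul, dotProduct]

end NonnegativeMatrix

namespace FusionRing

variable {I : Type} [Fintype I] [DecidableEq I]

/-- The fusion ring structure, with trivial involution, that a suitable basis of a commutative
ring defines. -/
def ofSelfDual {R : Type} [CommRing R] (b : Module.Basis I ℤ R) (u : I) (hu : b u = 1)
    (hnonneg : ∀ i j k, 0 ≤ b.repr (b i * b j) k)
    (hcoeff : ∀ i j, b.repr (b i * b j) u = if i = j then 1 else 0) : FusionRing R I where
  basis := b
  unit := u
  star := id
  basis_unit := hu
  nonneg := hnonneg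
  star_star _ := rfl
  star_anti := ⟨RingEquiv.toOpposite R, fun _ => rfl⟩
  unit_coeff := hcoeff

variable {R : Type} [Ring R] (F : FusionRing R I)

theorem sum_repr_mul_map_basis (χ : R →+* ℝ) (i j : I) :
    ∑ k, (F.basis.repr (F.basis i * F.basis j) k : ℝ) * χ (F.basis k) =
      χ (F.basis i) * χ (F.basis j) := by
  rw [← map_mul χ]
  conv_rhs => rw [← F.basis.sum_repr (F.basis i * F.basis j)]
  simp only [map_sum, zsmul_eq_mul, map_mul, map_intCast]

theorem FPdim_eq {χ : R →+* ℝ} (hχ : ∀ i, 0 < χ (F.basis i)) (i : I) :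
    F.FPdim i = χ (F.basis i) := by
  have hd : (fun k => χ (F.basis k)) ᵥ* (F.leftMulMatrix i).map (Int.cast : ℤ → ℝ) =
      χ (F.basis i) • fun k => χ (F.basis k) := by
    ext j
    rw [Pi.smul_apply, smul_eq_mul, ← F.sum_repr_mul_map_basis χ i j]
    exact Finset.sum_congr rfl fun k _ => mul_comm _ _
  refine IsGreatest.csSup_eq ⟨hasEigenvalue_toLin'_of_vecMul_eq_smul ?_ hd, fun t ht =>
    le_of_hasEigenvalue_of_vecMul_eq_smul (fun k j => ?_) hχ hd ht⟩
  · exact fun h => (hχ i).ne' (congrFun h i)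
  · exact Int.cast_nonneg (F.nonneg i j k)

theorem map_basis_star {χ : R →+* ℝ} (hχ : ∀ i, 0 < χ (F.basis i)) (i : I) :
    χ (F.basis (F.star i)) = χ (F.basis i) := by
  obtain ⟨φ, hφ⟩ := F.star_anti
  let χ' : R →+* ℝ := (RingEquiv.toOpposite ℝ).symm.toRingHom.comp (χ.op.comp φ.toRingHom)
  have hχ' (j : I) : χ' (F.basis j) = χ (F.basis (F.star j)) := by simp [χ', hφ]
  rw [← hχ', ← F.FPdim_eq hχ, F.FPdim_eq fun j => (hχ' j).symm ▸ hχ (F.star j)]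

variable {χ : R →+* ℝ} (hχ : ∀ i, 0 < χ (F.basis i))

/-- The basis `b_i / χ(b_i)` of `ℝ ⊗ R`, for a character `χ` that is positive on the `b_i`. -/
def normalizedBasis : Module.Basis I ℝ (ℝ ⊗[ℤ] R) :=
  (Algebra.TensorProduct.basis ℝ F.basis).unitsSMul fun i =>
    (Units.mk0 (χ (F.basis i)) (hχ i).ne')⁻¹

theorem normalizedBasis_apply (i : I) :
    F.normalizedBasis hχ i = (χ (F.basis i))⁻¹ • ((1 : ℝ) ⊗ₜ[ℤ] F.basis i) := by
  simp [normalizedBasis, Module.Basis.unitsSMul_apply, Units.smul_def]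

theorem normalizedBasis_repr_mul (i j k : I) :
    (F.normalizedBasis hχ).repr (F.normalizedBasis hχ i * F.normalizedBasis hχ j) k =
      (χ (F.basis i))⁻¹ * (χ (F.basis j))⁻¹ *
        (F.basis.repr (F.basis i * F.basis j) k * χ (F.basis k)) := by
  rw [F.normalizedBasis_apply, F.normalizedBasis_apply, smul_mul_smul_comm,
    Algebra.TensorProduct.tmul_mul_tmul, one_mul, map_smul, Finsupp.smul_apply,
    normalizedBasis, Module.Basis.repr_unitsSMul, Algebra.TensorProduct.basis_repr_tmul]
  simp [Units.smul_def, mul_comm]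

theorem exists_normalizedBasis_anti : ∃ φ : ℝ ⊗[ℤ] R ≃ₐ[ℝ] (ℝ ⊗[ℤ] R)ᵐᵒᵖ,
    ∀ i, φ (F.normalizedBasis hχ i) = MulOpposite.op (F.normalizedBasis hχ (F.star i)) := by
  obtain ⟨φ, hφ⟩ := F.star_anti
  refine ⟨(Algebra.TensorProduct.congr (AlgEquiv.toOpposite ℝ ℝ) φ.toIntAlgEquiv).trans
    (Algebra.TensorProduct.opAlgEquiv ℤ ℝ ℝ R), fun i => ?_⟩
  rw [F.normalizedBasis_apply, F.normalizedBasis_apply, F.map_basis_star hχ, map_smul,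
    MulOpposite.op_smul, ← MulOpposite.unop_op (F.basis (F.star i)), ← hφ]
  rfl

/-- The hypergroup that a fusion ring with a positive character defines. -/
def toHypergroup : Hypergroup (ℝ ⊗[ℤ] R) I where
  basis := F.normalizedBasis hχ
  unit := F.unit
  star := F.star
  basis_unit := by
    rw [F.normalizedBasis_apply, F.basis_unit, map_one, inv_one, one_smul,
      Algebra.TensorProduct.one_def]
  nonneg i j k := by
    rw [F.normalizedBasis_repr_mul]
    have := Int.cast_nonneg (R := ℝ) (F.nonneg i j k)
    have := hχ i
    have := hχ j
    have := hχ k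
    positivity
  sum_eq_one i j := by
    simp only [F.normalizedBasis_repr_mul]
    rw [← Finset.mul_sum, F.sum_repr_mul_map_basis, mul_mul_mul_comm,
      inv_mul_cancel₀ (hχ i).ne', inv_mul_cancel₀ (hχ j).ne', one_mul]
  star_star := F.star_star
  star_anti := F.exists_normalizedBasis_anti hχ
  unit_coeff_comm i j := by
    have hstar : i = F.star j ↔ j = F.star i :=
      eq_comm.trans (Function.Involutive.eq_iff F.star_star)
    simp only [F.normalizedBasis_repr_mul, F.unit_coeff, hstar]
    ring
  unit_coeff_pos i j := by
    have hstar : i = F.star j ↔ j = F.star i :=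
      eq_comm.trans (Function.Involutive.eq_iff F.star_star)
    have hpos := mul_pos (inv_pos.mpr (hχ i)) (inv_pos.mpr (hχ j))
    rw [F.normalizedBasis_repr_mul, F.unit_coeff, F.basis_unit, map_one, mul_one,
      mul_pos_iff_of_pos_left hpos, ← hstar, Int.cast_pos]
    split_ifs with hij <;> simp [hij]

end FusionRing

section IntegerMatrix

variable {V : Type*} [Fintype V] [DecidableEq V] (G : SimpleGraph V) [DecidableRel G.Adj]

theorem map_aeval_adjMatrix_chebyshevS (k : ℤ) :
    (aeval (G.adjMatrix ℤ) (Chebyshev.S ℤ k)).map (Int.cast : ℤ → ℝ) =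
      aeval (G.adjMatrix ℝ) (Chebyshev.S ℝ k) := by
  have hadj : (Int.castRingHom ℝ).mapMatrix (G.adjMatrix ℤ) = G.adjMatrix ℝ := by
    ext i j
    simp [SimpleGraph.adjMatrix_apply]
  have hmap := aeval_algHom_apply ((Int.castRingHom ℝ).mapMatrix (m := V)).toIntAlgHom
    (G.adjMatrix ℤ) (Chebyshev.S ℤ k)
  rw [← Chebyshev.map_S (algebraMap ℤ ℝ), aeval_map_algebraMap, ← hadj]
  exact hmap.symm

variable {G} {h : ℕ} {v : V → ℝ} (H : IsPerronVector G (2 * Real.cos (Real.pi / h)) v)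
  (hh : 2 ≤ h) (c : G.Coloring Bool)

include H hh c

theorem IsPerronVector.aeval_int_chebyshevS_nonneg {k : ℕ} (hk : k < h) (i j : V) :
    0 ≤ aeval (G.adjMatrix ℤ) (Chebyshev.S ℤ k) i j := by
  have := H.aeval_chebyshevS_nonneg hh c hk i j
  rw [← map_aeval_adjMatrix_chebyshevS, Matrix.map_apply] at this
  exact_mod_cast this

theorem IsPerronVector.aeval_int_chebyshevS_sub_one_eq_zero :
    aeval (G.adjMatrix ℤ) (Chebyshev.S ℤ (h - 1 : ℕ)) = 0 := by
  refine map_injective (Int.cast_injective (α := ℝ)) ?_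
  beta_reduce
  rw [map_aeval_adjMatrix_chebyshevS, Nat.cast_pred (by omega),
    H.aeval_chebyshevS_sub_one_eq_zero hh c, Matrix.map_zero _ Int.cast_zero]

end IntegerMatrix

section VerlindeRing

variable {n : ℕ}

/-- The ring homomorphism from the Verlinde ring to a (possibly noncommutative) ring that sends
`Δ_1` to `a`. -/
def verlindeLift {S : Type*} [Ring S] (a : S) (ha : aeval a (Chebyshev.S ℤ n) = 0) :
    VerlindeRing n →+* S :=
  Ideal.Quotient.lift _ (aeval a).toRingHom fun p hp => by
    obtain ⟨q, rfl⟩ := Ideal.mem_span_singleton.mp hp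
    simp [ha]

theorem verlindeLift_delta {S : Type*} [Ring S] (a : S) (ha : aeval a (Chebyshev.S ℤ n) = 0)
    (k : ℕ) : verlindeLift a ha (verlindeDelta n k) = aeval a (Chebyshev.S ℤ k) :=
  rfl

theorem verlindeDelta_zero : verlindeDelta n 0 = 1 := by simp [verlindeDelta]

theorem root_mul_verlindeDelta (k : ℕ) :
    AdjoinRoot.root (Chebyshev.S ℤ n) * verlindeDelta n (k + 1) =
      verlindeDelta n (k + 2) + verlindeDelta n k := by
  simp [verlindeDelta, Chebyshev.S_add_two]

theorem span_verlindeDelta [NeZero n] :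
    Submodule.span ℤ (Set.range fun k : Fin n => verlindeDelta n k) = ⊤ := by
  set M := Submodule.span ℤ (Set.range fun k : Fin n => verlindeDelta n k)
  have hmem {k : ℕ} (hk : k ≤ n) : verlindeDelta n k ∈ M := by
    obtain hk | rfl := hk.lt_or_eq
    · exact Submodule.subset_span ⟨⟨k, hk⟩, rfl⟩
    · rw [verlindeDelta, AdjoinRoot.mk_self]
      exact M.zero_mem
  have hroot : M ≤ M.comap (Algebra.lsmul ℤ ℤ _ (AdjoinRoot.root (Chebyshev.S ℤ n))) := by
    refine Submodule.span_le.mpr ?_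
    rintro _ ⟨⟨k, hk⟩, rfl⟩
    change AdjoinRoot.root _ * verlindeDelta n k ∈ M
    cases k with
    | zero => simpa [verlindeDelta] using hmem (k := 1) (by omega)
    | succ k =>
      rw [root_mul_verlindeDelta]
      exact M.add_mem (hmem hk) (hmem (by omega))
  refine Submodule.eq_top_iff'.mpr fun x => ?_
  obtain ⟨p, rfl⟩ := AdjoinRoot.mk_surjective x
  rw [← AdjoinRoot.aeval_eq, ← mul_one (aeval _ p), ← smul_eq_mul, ← verlindeDelta_zero]
  exact aeval_apply_smul_mem_of_le_comap' (hmem (Nat.zero_le n)) p _ hroot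

end VerlindeRing

section VerlindeBasis

variable (n : ℕ) [NeZero n]

/-- The adjacency matrix of the path with `n` vertices, by which `Δ_1` acts on the Verlinde ring
`R_n` in the basis `Δ_k`. -/
def pathMatrix : Matrix (Fin n) (Fin n) ℤ :=
  (ADEDiagram.A n NeZero.one_le).graph.adjMatrix ℤ

variable {n} in
theorem pathMatrix_apply (i j : Fin n) :
    pathMatrix n i j = if (j : ℕ) = i + 1 ∨ (i : ℕ) = j + 1 then 1 else 0 := by
  have hadj : (ADEDiagram.A n NeZero.one_le).graph.Adj i j ↔ (j : ℕ) = i + 1 ∨ (i : ℕ) = j + 1 :=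
    ADEDiagram.graph_adj
  split_ifs with h
  · exact if_pos (hadj.2 h)
  · exact if_neg (mt hadj.1 h)

theorem isSymm_aeval_pathMatrix (p : ℤ[X]) : (aeval (pathMatrix n) p).IsSymm :=
  isSymm_aeval (A := pathMatrix n)
    (SimpleGraph.isSymm_adjMatrix (ADEDiagram.A n NeZero.one_le).graph) p

theorem aeval_pathMatrix_chebyshevS_nonneg {k : ℕ} (hk : k ≤ n) (i j : Fin n) :
    0 ≤ aeval (pathMatrix n) (Chebyshev.S ℤ k) i j := by
  obtain ⟨c, -⟩ := (ADEDiagram.A n NeZero.one_le).exists_coloring_root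
  exact (ADEDiagram.isPerronVector_A n _).aeval_int_chebyshevS_nonneg
    (by have := NeZero.one_le (n := n); omega) c (by omega) i j

theorem aeval_pathMatrix_chebyshevS_self : aeval (pathMatrix n) (Chebyshev.S ℤ n) = 0 := by
  obtain ⟨c, -⟩ := (ADEDiagram.A n NeZero.one_le).exists_coloring_root
  exact (ADEDiagram.isPerronVector_A n _).aeval_int_chebyshevS_sub_one_eq_zero
    (by have := NeZero.one_le (n := n); omega) c

theorem aeval_pathMatrix_chebyshevS_mulVec_single_zero (k : Fin n) :
    aeval (pathMatrix n) (Chebyshev.S ℤ (k : ℕ)) *ᵥ Pi.single 0 1 = Pi.single k 1 := by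
  obtain ⟨k, hk⟩ := k
  induction k using Nat.twoStepInduction with
  | zero =>
    ext i
    simp [one_apply, Pi.single_apply]
  | one =>
    ext i
    simp only [Nat.cast_one, Chebyshev.S_one, aeval_X, mulVec_single_one, col_apply,
      pathMatrix_apply, Pi.single_apply, Fin.ext_iff, Fin.val_zero]
    exact if_congr (by omega) rfl rfl
  | more k h0 h1 =>
    ext i
    rw [Nat.cast_add, Nat.cast_ofNat, Chebyshev.S_add_two, map_sub, map_mul, aeval_X, sub_mulVec,
      ← mulVec_mulVec, h0 (by omega), ← Nat.cast_succ, h1 (by omega)]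
    simp only [Pi.sub_apply, mulVec_single_one, col_apply, pathMatrix_apply, Pi.single_apply,
      Fin.ext_iff]
    split_ifs <;> omega

/-- The regular representation of the Verlinde ring, in the basis `Δ_k`. -/
def verlindeRegular : VerlindeRing n →+* Matrix (Fin n) (Fin n) ℤ :=
  verlindeLift (pathMatrix n) (aeval_pathMatrix_chebyshevS_self n)

/-- The coordinates for the basis `Δ_k`, read off from the action on the first vertex of the
path. -/
def verlindeCoord : VerlindeRing n →ₗ[ℤ] Fin n → ℤ :=
  (AddMonoidHom.mk' (fun x => verlindeRegular n x *ᵥ Pi.single 0 1)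
    fun x y => by rw [map_add, add_mulVec]).toIntLinearMap

variable {n}

theorem verlindeRegular_delta (k : ℕ) :
    verlindeRegular n (verlindeDelta n k) = aeval (pathMatrix n) (Chebyshev.S ℤ k) :=
  rfl

theorem verlindeCoord_apply (x : VerlindeRing n) :
    verlindeCoord n x = verlindeRegular n x *ᵥ Pi.single 0 1 :=
  rfl

theorem verlindeCoord_delta (k : Fin n) : verlindeCoord n (verlindeDelta n k) = Pi.single k 1 :=
  aeval_pathMatrix_chebyshevS_mulVec_single_zero n k

theorem verlindeCoord_mul_delta (x : VerlindeRing n) (j k : Fin n) :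
    verlindeCoord n (x * verlindeDelta n j) k = verlindeRegular n x k j := by
  rw [verlindeCoord_apply, map_mul, ← mulVec_mulVec, ← verlindeCoord_apply, verlindeCoord_delta,
    mulVec_single_one, col_apply]

variable (n) in
/-- The basis `Δ_k` of the Verlinde ring. -/
def verlindeBasis : Module.Basis (Fin n) ℤ (VerlindeRing n) :=
  .mk (v := fun k : Fin n => verlindeDelta n k)
    (.of_comp (verlindeCoord n) <| by
      rw [show verlindeCoord n ∘ (fun k : Fin n => verlindeDelta n k) = fun k => Pi.single k 1 from
        funext verlindeCoord_delta]
      exact Pi.linearIndependent_single_one (Fin n) ℤ)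
    span_verlindeDelta.ge

theorem verlindeBasis_apply (k : Fin n) : verlindeBasis n k = verlindeDelta n k :=
  Module.Basis.mk_apply _ _ _

theorem verlindeBasis_repr (x : VerlindeRing n) (k : Fin n) :
    (verlindeBasis n).repr x k = verlindeCoord n x k := by
  have h : (verlindeBasis n).equivFun.toLinearMap = verlindeCoord n :=
    (verlindeBasis n).ext fun i => by
      ext j
      rw [LinearEquiv.coe_coe, Module.Basis.equivFun_self, verlindeBasis_apply, verlindeCoord_delta,
        Pi.single_apply, if_congr eq_comm rfl rfl]
  rw [← h, LinearEquiv.coe_coe, Module.Basis.equivFun_apply]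

theorem verlindeBasis_repr_mul (i j k : Fin n) :
    (verlindeBasis n).repr (verlindeBasis n i * verlindeBasis n j) k =
      aeval (pathMatrix n) (Chebyshev.S ℤ (i : ℕ)) k j := by
  rw [verlindeBasis_repr, verlindeBasis_apply, verlindeBasis_apply, verlindeCoord_mul_delta,
    verlindeRegular_delta]

variable (n) in
/-- The fusion ring structure on the Verlinde ring. -/
def verlindeFusion : FusionRing (VerlindeRing n) (Fin n) :=
  .ofSelfDual (verlindeBasis n) 0 ((verlindeBasis_apply 0).trans verlindeDelta_zero)
    (fun i j k => by
      rw [verlindeBasis_repr_mul]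
      exact aeval_pathMatrix_chebyshevS_nonneg n i.2.le k j)
    (fun i j => by
      have h := congrFun (aeval_pathMatrix_chebyshevS_mulVec_single_zero n i) j
      rw [mulVec_single_one, col_apply, Pi.single_apply, if_congr eq_comm rfl rfl] at h
      rw [verlindeBasis_repr_mul, ← h, (isSymm_aeval_pathMatrix n _).apply])

end VerlindeBasis

section EvenPart

variable (n : ℕ)

theorem aeval_neg_root_chebyshevS (k : ℕ) :
    aeval (-AdjoinRoot.root (Chebyshev.S ℤ n)) (Chebyshev.S ℤ k) = (-1) ^ k * verlindeDelta n k :=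
  (aeval_neg_chebyshevS _ k).trans (congrArg _ (AdjoinRoot.aeval_eq _))

/-- The grading involution of the Verlinde ring, which sends `Δ_1` to `-Δ_1`. -/
def verlindeParity : VerlindeRing n →+* VerlindeRing n :=
  verlindeLift (-AdjoinRoot.root (Chebyshev.S ℤ n)) <|
    (aeval_neg_root_chebyshevS n n).trans (by rw [verlindeDelta, AdjoinRoot.mk_self, mul_zero])

variable {n}

theorem verlindeParity_delta (k : ℕ) :
    verlindeParity n (verlindeDelta n k) = (-1) ^ k * verlindeDelta n k :=
  aeval_neg_root_chebyshevS n k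

theorem verlindeParity_eq_self {x : VerlindeRing n} (hx : x ∈ verlindeEven n) :
    verlindeParity n x = x := by
  refine RingHom.eqOn_set_closure (g := RingHom.id _) ?_ hx
  rintro _ ⟨k, -, rfl⟩
  rw [verlindeParity_delta, (even_two_mul k).neg_one_pow, one_mul, RingHom.id_apply]

variable [NeZero n]

theorem verlindeBasis_repr_parity (x : VerlindeRing n) (k : Fin n) :
    (verlindeBasis n).repr (verlindeParity n x) k =
      (-1) ^ (k : ℕ) * (verlindeBasis n).repr x k := by
  have h : (verlindeBasis n).coord k ∘ₗ (verlindeParity n).toIntAlgHom.toLinearMap =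
      ((-1) ^ (k : ℕ) : ℤ) • (verlindeBasis n).coord k := by
    refine (verlindeBasis n).ext fun j => ?_
    have hj : verlindeParity n (verlindeBasis n j) = ((-1) ^ (j : ℕ) : ℤ) • verlindeBasis n j := by
      rw [verlindeBasis_apply, verlindeParity_delta, zsmul_eq_mul]
      push_cast
      rfl
    change (verlindeBasis n).repr (verlindeParity n (verlindeBasis n j)) k =
      (-1) ^ (k : ℕ) * (verlindeBasis n).repr (verlindeBasis n j) k
    rw [hj, map_zsmul, Finsupp.smul_apply, Module.Basis.repr_self, Finsupp.single_apply]
    split_ifs with hjk <;> simp [hjk]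
  exact LinearMap.congr_fun h x

theorem verlindeBasis_repr_eq_zero_of_odd {x : VerlindeRing n} (hx : x ∈ verlindeEven n)
    {k : Fin n} (hk : Odd (k : ℕ)) : (verlindeBasis n).repr x k = 0 := by
  have h := verlindeBasis_repr_parity x k
  rw [verlindeParity_eq_self hx, hk.neg_one_pow] at h
  omega

/-- The index in the basis `Δ_k` of the element `Δ_{2k}` of the basis of the even part. -/
def evenIndex (k : Fin ((n - 1) / 2 + 1)) : Fin n :=
  ⟨2 * k, by have := NeZero.one_le (n := n); omega⟩

theorem evenIndex_injective : Function.Injective (evenIndex (n := n)) := fun i j h => by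
  simpa [evenIndex, Fin.ext_iff] using h

theorem mem_range_evenIndex {k : Fin n} (hk : Even (k : ℕ)) :
    k ∈ Set.range (evenIndex (n := n)) := by
  obtain ⟨r, hr⟩ := hk
  exact ⟨⟨r, by omega⟩, Fin.ext (by simp only [evenIndex]; omega)⟩

variable (n) in
/-- The element `Δ_{2k}` of the even part. -/
def evenDelta (k : Fin ((n - 1) / 2 + 1)) : verlindeEven n :=
  ⟨verlindeDelta n (2 * k), Subring.subset_closure ⟨k, by omega, rfl⟩⟩

theorem coe_evenDelta (k : Fin ((n - 1) / 2 + 1)) :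
    (evenDelta n k : VerlindeRing n) = verlindeBasis n (evenIndex k) :=
  (verlindeBasis_apply (evenIndex k)).symm

theorem sum_verlindeBasis_repr_smul_evenDelta (x : verlindeEven n) :
    ∑ k, (verlindeBasis n).repr x (evenIndex k) • evenDelta n k = x := by
  refine Subtype.ext ?_
  rw [AddSubmonoidClass.coe_finsetSum]
  conv_rhs => rw [← (verlindeBasis n).sum_repr x]
  refine Fintype.sum_of_injective _ evenIndex_injective _ _ (fun k hk => ?_) fun k => by
    rw [AddSubgroupClass.coe_zsmul, coe_evenDelta]
  rw [verlindeBasis_repr_eq_zero_of_odd x.2, zero_smul]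
  exact Nat.not_even_iff_odd.mp fun h => hk (mem_range_evenIndex h)

variable (n) in
/-- The basis `Δ_{2k}` of the even part of the Verlinde ring. -/
def evenBasis : Module.Basis (Fin ((n - 1) / 2 + 1)) ℤ (verlindeEven n) :=
  .mk (v := evenDelta n)
    (.of_comp (verlindeEven n).subtype.toIntAlgHom.toLinearMap <| by
      rw [show (verlindeEven n).subtype.toIntAlgHom.toLinearMap ∘ evenDelta n =
        verlindeBasis n ∘ evenIndex from funext coe_evenDelta]
      exact (verlindeBasis n).linearIndependent.comp _ evenIndex_injective)
    fun x _ => by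
      rw [← sum_verlindeBasis_repr_smul_evenDelta x]
      exact Submodule.sum_mem _ fun k _ =>
        Submodule.smul_mem _ _ (Submodule.subset_span (Set.mem_range_self k))

theorem evenBasis_apply (k : Fin ((n - 1) / 2 + 1)) : evenBasis n k = evenDelta n k :=
  Module.Basis.mk_apply _ _ _

theorem evenBasis_repr (x : verlindeEven n) (k : Fin ((n - 1) / 2 + 1)) :
    (evenBasis n).repr x k = (verlindeBasis n).repr x (evenIndex k) := by
  conv_lhs => rw [← sum_verlindeBasis_repr_smul_evenDelta x]
  simp only [← evenBasis_apply]
  rw [Module.Basis.repr_sum_self]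

theorem evenBasis_repr_mul (i j k : Fin ((n - 1) / 2 + 1)) :
    (evenBasis n).repr (evenBasis n i * evenBasis n j) k =
      (verlindeBasis n).repr (verlindeBasis n (evenIndex i) * verlindeBasis n (evenIndex j))
        (evenIndex k) := by
  rw [evenBasis_repr, evenBasis_apply, evenBasis_apply, Subring.coe_mul, coe_evenDelta,
    coe_evenDelta]

variable (n) in
/-- The fusion ring structure on the even part of the Verlinde ring. -/
def evenFusion : FusionRing (verlindeEven n) (Fin ((n - 1) / 2 + 1)) :=
  .ofSelfDual (evenBasis n) 0
    (by rw [evenBasis_apply]; exact Subtype.ext verlindeDelta_zero)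
    (fun i j k => by
      rw [evenBasis_repr_mul]
      exact (verlindeFusion n).nonneg _ _ _)
    (fun i j => by
      rw [evenBasis_repr_mul]
      exact ((verlindeFusion n).unit_coeff _ _).trans
        (if_congr evenIndex_injective.eq_iff rfl rfl))

end EvenPart

namespace ADEDiagram

variable (Γ : ADEDiagram)

instance : NeZero (Γ.coxeterNumber - 1) := ⟨by have := Γ.two_le_coxeterNumber; omega⟩

/-- The character of the Verlinde ring `R_{h-1}` with value `2 cos (π / h)` at `Δ_1`. -/
def character : VerlindeRing (Γ.coxeterNumber - 1) →+* ℝ :=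
  verlindeLift (2 * Real.cos (Real.pi / Γ.coxeterNumber)) <| by
    rw [Chebyshev.aeval_S, Nat.cast_pred (by have := Γ.two_le_coxeterNumber; omega)]
    exact eval_chebyshevS_sub_one_eq_zero Γ.two_le_coxeterNumber

/-- The action of the Verlinde ring `R_{h-1}` on the lattice `M_Γ`. -/
def action : VerlindeRing (Γ.coxeterNumber - 1) →+* Matrix (Fin Γ.rank) (Fin Γ.rank) ℤ :=
  verlindeLift (Γ.graph.adjMatrix ℤ) <| by
    obtain ⟨v, H⟩ := Γ.exists_isPerronVector_coxeterNumber
    obtain ⟨c, -⟩ := Γ.exists_coloring_root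
    exact H.aeval_int_chebyshevS_sub_one_eq_zero Γ.two_le_coxeterNumber c

theorem character_delta (k : ℕ) : Γ.character (verlindeDelta _ k) =
    (Chebyshev.S ℝ k).eval (2 * Real.cos (Real.pi / Γ.coxeterNumber)) := by
  rw [character, verlindeLift_delta, Chebyshev.aeval_S]

theorem action_delta (k : ℕ) :
    Γ.action (verlindeDelta _ k) = aeval (Γ.graph.adjMatrix ℤ) (Chebyshev.S ℤ k) :=
  rfl

theorem action_delta_one : Γ.action (verlindeDelta _ 1) = Γ.graph.adjMatrix ℤ := by
  rw [action_delta, Nat.cast_one, Chebyshev.S_one, aeval_X]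

theorem isZPlusModule_action : (verlindeFusion _).IsZPlusModule Γ.action := fun k i j => by
  obtain ⟨v, H⟩ := Γ.exists_isPerronVector_coxeterNumber
  obtain ⟨c, -⟩ := Γ.exists_coloring_root
  have hk : Γ.action ((verlindeFusion _).basis k) =
      aeval (Γ.graph.adjMatrix ℤ) (Chebyshev.S ℤ (k : ℕ)) :=
    congrArg Γ.action (verlindeBasis_apply k)
  rw [hk]
  exact H.aeval_int_chebyshevS_nonneg Γ.two_le_coxeterNumber c (by omega) i j

/-- The restriction of `Γ.character` to the even part of the Verlinde ring. -/
def evenCharacter : verlindeEven (Γ.coxeterNumber - 1) →+* ℝ :=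
  Γ.character.comp (verlindeEven _).subtype

theorem evenCharacter_basis (k : Fin ((Γ.coxeterNumber - 1 - 1) / 2 + 1)) :
    Γ.evenCharacter ((evenFusion _).basis k) =
      (Chebyshev.S ℝ (2 * (k : ℕ) : ℕ)).eval (2 * Real.cos (Real.pi / Γ.coxeterNumber)) :=
  (congrArg Γ.evenCharacter (evenBasis_apply k)).trans (Γ.character_delta _)

theorem evenCharacter_basis_pos (k : Fin ((Γ.coxeterNumber - 1 - 1) / 2 + 1)) :
    0 < Γ.evenCharacter ((evenFusion _).basis k) := by
  rw [evenCharacter_basis]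
  have := Γ.two_le_coxeterNumber
  exact eval_chebyshevS_pos (by omega)

/-- The hypergroup defined by the even part of the Verlinde ring `R_{h-1}`. -/
def evenHypergroup : Hypergroup (ℝ ⊗[ℤ] verlindeEven (Γ.coxeterNumber - 1))
    (Fin ((Γ.coxeterNumber - 1 - 1) / 2 + 1)) :=
  (evenFusion _).toHypergroup Γ.evenCharacter_basis_pos

theorem evenHypergroup_basis (k : Fin ((Γ.coxeterNumber - 1 - 1) / 2 + 1)) :
    Γ.evenHypergroup.basis k =
      ((evenFusion _).FPdim k)⁻¹ • ((1 : ℝ) ⊗ₜ[ℤ] (evenFusion _).basis k) := by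
  rw [(evenFusion _).FPdim_eq Γ.evenCharacter_basis_pos]
  exact (evenFusion _).normalizedBasis_apply Γ.evenCharacter_basis_pos k

/-- The action on `V_Γ` of the hypergroup defined by the even part of the Verlinde ring. -/
def hypergroupAction :
    ℝ ⊗[ℤ] verlindeEven (Γ.coxeterNumber - 1) →ₐ[ℝ] Matrix (Fin Γ.rank) (Fin Γ.rank) ℝ :=
  extendScalars (Γ.action.comp (verlindeEven _).subtype)

theorem hypergroupAction_basis (k : Fin ((Γ.coxeterNumber - 1 - 1) / 2 + 1)) :
    Γ.hypergroupAction (Γ.evenHypergroup.basis k) =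
      (Γ.evenCharacter ((evenFusion _).basis k))⁻¹ •
        aeval (Γ.graph.adjMatrix ℝ) (Chebyshev.S ℝ (2 * (k : ℕ) : ℕ)) := by
  have hk : Γ.action.comp (verlindeEven _).subtype ((evenFusion _).basis k) =
      aeval (Γ.graph.adjMatrix ℤ) (Chebyshev.S ℤ (2 * (k : ℕ) : ℕ)) :=
    congrArg (Γ.action.comp (verlindeEven _).subtype) (evenBasis_apply k)
  rw [evenHypergroup_basis, (evenFusion _).FPdim_eq Γ.evenCharacter_basis_pos, map_smul,
    hypergroupAction, extendScalars_tmul, one_smul, hk, map_aeval_adjMatrix_chebyshevS]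

variable {Γ} in
theorem mem_fixedPoints_iff {w : Γ.V} :
    w ∈ Γ.evenHypergroup.fixedPoints Γ.hypergroupAction ↔
      ∀ k : Fin ((Γ.coxeterNumber - 1 - 1) / 2 + 1),
        aeval (Γ.graph.adjMatrix ℝ) (Chebyshev.S ℝ (2 * (k : ℕ) : ℕ)) *ᵥ w =
          (Chebyshev.S ℝ (2 * (k : ℕ) : ℕ)).eval (2 * Real.cos (Real.pi / Γ.coxeterNumber)) • w :=
  forall_congr' fun k => by
    rw [hypergroupAction_basis, smul_mulVec, inv_smul_eq_iff₀ (Γ.evenCharacter_basis_pos k).ne',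
      evenCharacter_basis]

variable {Γ} in
theorem mem_coxeterPlane_iff_chebyshevS_two {w : Γ.V} :
    w ∈ Γ.coxeterPlane ↔ aeval (Γ.graph.adjMatrix ℝ) (Chebyshev.S ℝ 2) *ᵥ w =
      (Chebyshev.S ℝ 2).eval (2 * Real.cos (Real.pi / Γ.coxeterNumber)) • w := by
  rw [mem_coxeterPlane_iff, Chebyshev.S_two]
  simp only [map_sub, map_pow, aeval_X, map_one, sub_mulVec, one_mulVec, eval_sub, eval_pow, eval_X,
    eval_one, sub_smul, one_smul, sub_left_inj]

theorem aeval_chebyshevS_two_mul_mulVec {w : Γ.V} (hw : w ∈ Γ.coxeterPlane) (k : ℕ) :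
    aeval (Γ.graph.adjMatrix ℝ) (Chebyshev.S ℝ (2 * k : ℕ)) *ᵥ w =
      (Chebyshev.S ℝ (2 * k : ℕ)).eval (2 * Real.cos (Real.pi / Γ.coxeterNumber)) • w := by
  obtain ⟨q, hq⟩ := exists_chebyshevS_two_mul_eq_expand (R := ℝ) k
  push_cast
  rw [hq, expand_aeval, expand_eval]
  exact aeval_mulVec_of_mulVec_eq_smul (Γ.mem_coxeterPlane_iff.mp hw) q

variable {Γ} in
theorem mem_coxeterPlane_of_mem_fixedPoints {w : Γ.V}
    (hw : w ∈ Γ.evenHypergroup.fixedPoints Γ.hypergroupAction) : w ∈ Γ.coxeterPlane := by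
  have hh := Γ.two_le_coxeterNumber
  obtain ⟨v, H⟩ := Γ.exists_isPerronVector_coxeterNumber
  obtain ⟨c, -⟩ := Γ.exists_coloring_root
  have hA := H.aeval_chebyshevS_sub_one_eq_zero hh c
  have ht := eval_chebyshevS_sub_one_eq_zero hh
  obtain h2 | h3 | h4 : (Γ.coxeterNumber : ℤ) - 1 = 1 ∨ (Γ.coxeterNumber : ℤ) - 1 = 2 ∨
    4 ≤ Γ.coxeterNumber := by omega
  · rw [h2, Chebyshev.S_one, aeval_X] at hA
    rw [h2, Chebyshev.S_one, eval_X] at ht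
    rw [mem_coxeterPlane_iff, hA, ht, zero_pow two_ne_zero, zero_mulVec, zero_pow two_ne_zero,
      zero_smul]
  · rw [h3] at hA ht
    rw [mem_coxeterPlane_iff_chebyshevS_two, hA, ht, zero_mulVec, zero_smul]
  · exact mem_coxeterPlane_iff_chebyshevS_two.mpr (mem_fixedPoints_iff.mp hw ⟨1, by omega⟩)

theorem fixedPoints_eq_coxeterPlane :
    Γ.evenHypergroup.fixedPoints Γ.hypergroupAction = Γ.coxeterPlane :=
  le_antisymm (fun _ => mem_coxeterPlane_of_mem_fixedPoints) fun _ hw =>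
    mem_fixedPoints_iff.mpr fun k => Γ.aeval_chebyshevS_two_mul_mulVec hw k

end ADEDiagram

end

/-- Let `Γ` be an ADE Dynkin diagram with Coxeter number `h`. The Verlinde ring `R_{h-1}` and its
even part are fusion rings (`F`, `E`) for the bases `Δ_k` and `Δ_{2k}`, the even part induces a
hypergroup `H` with basis `Δ_{2k} / FPdim(Δ_{2k})`, there is a `ℤ₊`-module `M_Γ` over `R_{h-1}` on
which `Δ_1` acts by the adjacency matrix (`ρ`), and the fixed points of the induced action of `H` on
`V_Γ` are the Coxeter plane. The data `F`, `E`, `H`, `ρ` are uniquely determined by the stated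
properties. The numbers `± 2 cos (π / h)` are simple eigenvalues of `2 I - 𝔄`, and the Coxeter plane
has dimension `2` if the rank is at least `2` (for `A 1`, `h = 2` and it is the line `V_Γ`). -/
theorem theorem4p1 (Γ : ADEDiagram) :
    ∃ (F : FusionRing (VerlindeRing (Γ.coxeterNumber - 1)) (Fin (Γ.coxeterNumber - 1)))
      (E : FusionRing (verlindeEven (Γ.coxeterNumber - 1))
        (Fin ((Γ.coxeterNumber - 1 - 1) / 2 + 1)))
      (H : Hypergroup (ℝ ⊗[ℤ] verlindeEven (Γ.coxeterNumber - 1))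
        (Fin ((Γ.coxeterNumber - 1 - 1) / 2 + 1)))
      (ρ : VerlindeRing (Γ.coxeterNumber - 1) →+* Matrix (Fin Γ.rank) (Fin Γ.rank) ℤ),
      (∀ k, F.basis k = verlindeDelta (Γ.coxeterNumber - 1) k) ∧
      (∀ k, (E.basis k : VerlindeRing (Γ.coxeterNumber - 1)) =
        verlindeDelta (Γ.coxeterNumber - 1) (2 * k)) ∧
      (∀ k, H.basis k = (E.FPdim k)⁻¹ • ((1 : ℝ) ⊗ₜ[ℤ] E.basis k)) ∧
      ρ (verlindeDelta (Γ.coxeterNumber - 1) 1) = Γ.graph.adjMatrix ℤ ∧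
      F.IsZPlusModule ρ ∧
      H.fixedPoints
        (extendScalars (ρ.comp (verlindeEven (Γ.coxeterNumber - 1)).subtype)) =
          Γ.coxeterPlane ∧
      Module.finrank ℝ (Γ.eigenspace (2 * Real.cos (Real.pi / (Γ.coxeterNumber : ℝ)))) = 1 ∧
      Module.finrank ℝ (Γ.eigenspace (-(2 * Real.cos (Real.pi / (Γ.coxeterNumber : ℝ))))) = 1 ∧
      (2 ≤ Γ.rank → Module.finrank ℝ Γ.coxeterPlane = 2) := by
  exact ⟨verlindeFusion _, evenFusion _, Γ.evenHypergroup, Γ.action,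
    verlindeBasis_apply,
    fun k => congrArg Subtype.val (evenBasis_apply k),
    Γ.evenHypergroup_basis,
    Γ.action_delta_one,
    Γ.isZPlusModule_action,
    Γ.fixedPoints_eq_coxeterPlane,
    Γ.finrank_eigenspace,
    Γ.finrank_eigenspace_neg,
    Γ.finrank_coxeterPlane⟩
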